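/- **Conventions.** Locally convex spaces are real, Hausdorff, locally convex topological vector spaces. Let $X,Y$ be locally convex spaces and let $A\subseteq X$ have dense interior. A map $f\colon A\to Y$ is *smooth* if it is continuous, all iterated directional differentials $$d^{n}f(x).(v_1,\dots,v_n)=\lim_{h\to 0}\tfrac1h\bigl(d^{n-1}f(x+hv_n).(v_1,\dots,v_{n-1})-d^{n-1}f(x).(v_1,\dots,v_{n-1})\bigr)\qquad(n\ge 1,\ d^0f=f)$$ exist for $x$ in the interior $A^\circ$ of $A$ and $v_1,\dots,v_n\in X$, and each $d^nf\colon A^{\circ}\times X^n\to Y$ is continuous and extends continuously to $A\times X^n$. A *locally convex manifold* is a Hausdorff space $N$ together with an atlas of charts, i.e. homeomorphisms from open subsets covering $N$ onto open subsets of locally convex spaces, whose coordinate changes are smooth. A *$d$-dimensional manifold with corners* is a paracompact Hausdorff space $M$ with an atlas of charts onto open subsets of $\mathbb{R}^d_+=\{x\in\mathbb{R}^d : x_i\ge 0 \text{ for all } i\}$ whose coordinate changes are smooth. A map from a manifold with corners to a locally convex manifold is *smooth* if it is continuous and all its local representatives in charts are smooth. The product $[0,1]\times M$ carries its product structure of a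 manifold with corners. **Corollary.** Let $M$ be a connected manifold with corners of finite dimension $d\ge 0$, and let $N$ be a locally convex manifold. 1. Every continuous map $f\colon M\to N$ is homotopic to a smooth map $g\colon M\to N$. 2. Two smooth maps $f,g\colon M\to N$ are homotopic (i.e. there is a continuous map $F\colon[0,1]\times M\to N$ with $F(0,\cdot)=f$ and $F(1,\cdot)=g$) if and only if they are smoothly homotopic, i.e. there is a smooth map $F\colon[0,1]\times M\to N$ with $F(0,\cdot)=f$ and $F(1,\cdot)=g$. -/

import Mathlib

open Set Filter Topology
open scoped Manifold ContDiff

/-!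
## Differential calculus in locally convex spaces
-/

/-- `y` is the directional derivative `lim_{h → 0} (1/h) (f (x + h v) - f x)` of `f` at `x` in the
direction `v`. -/
def HasDirectionalDeriv {X Y : Type*} [AddCommGroup X] [Module ℝ X]
    [AddCommGroup Y] [Module ℝ Y] [TopologicalSpace Y]
    (f : X → Y) (y : Y) (x v : X) : Prop :=
  Tendsto (fun h : ℝ => h⁻¹ • (f (x + h • v) - f x)) (𝓝[≠] 0) (𝓝 y)

/-- `D n x (v₁, …, vₙ)` is the family of iterated differentials `dⁿf(x).(v₁, …, vₙ)` of `f`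
on the interior of `A`, obtained by successive directional differentiation, and each `D n` is
continuous on all of `A × Xⁿ`. (For `n = 0` this says that `f` is continuous on `A`.) -/
structure IsDifferentialTower {X Y : Type*} [AddCommGroup X] [Module ℝ X] [TopologicalSpace X]
    [AddCommGroup Y] [Module ℝ Y] [TopologicalSpace Y]
    (f : X → Y) (A : Set X) (D : (n : ℕ) → X → (Fin n → X) → Y) : Prop where
  zero_eq : ∀ x ∈ A, ∀ v : Fin 0 → X, D 0 x v = f x
  deriv_eq : ∀ (n : ℕ), ∀ x ∈ interior A, ∀ (v : Fin n → X) (w : X),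
    HasDirectionalDeriv (fun z => D n z v) (D (n + 1) x (Fin.snoc (α := fun _ => X) v w)) x w
  continuousOn : ∀ n : ℕ,
    ContinuousOn (fun p : X × (Fin n → X) => D n p.1 p.2) (A ×ˢ (univ : Set (Fin n → X)))

/-- Smoothness (`C^∞`) of `f` on a subset `A`, with dense interior, of a locally convex space, with
values in a Hausdorff locally convex space: all iterated differentials
`dⁿf : interior A × Xⁿ → Y` exist, are continuous, and extend continuously to `A × Xⁿ`.
When `A` is open this is the Michal--Bastiani (Keller `C^∞_c`) notion of smoothness. -/
def LCSmoothOn {X Y : Type*} [AddCommGroup X] [Module ℝ X] [TopologicalSpace X]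
    [AddCommGroup Y] [Module ℝ Y] [TopologicalSpace Y] (f : X → Y) (A : Set X) : Prop :=
  ∃ D : (n : ℕ) → X → (Fin n → X) → Y, IsDifferentialTower f A D

/-!
## Locally convex manifolds
-/

/-- A smooth atlas on `N`: charts `chart i`, which are homeomorphisms from open subsets of `N` onto
open subsets of locally convex spaces `E i` (the model space may depend on the chart), whose
domains cover `N` and whose coordinate changes are smooth. A locally convex manifold is
a Hausdorff space with such an atlas. -/
structure LCAtlas {ι : Type*} (E : ι → Type*) [∀ i, AddCommGroup (E i)] [∀ i, Module ℝ (E i)]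
    [∀ i, TopologicalSpace (E i)] (N : Type*) [TopologicalSpace N] where
  chart : (i : ι) → OpenPartialHomeomorph N (E i)
  cover : ∀ y : N, ∃ i, y ∈ (chart i).source
  smooth_change : ∀ i j,
    LCSmoothOn (chart j ∘ (chart i).symm) ((chart i).symm.trans (chart j)).source

/-- Smooth maps from a manifold with corners `P` (with model `I`) to a locally convex manifold `N`:
continuous maps all of whose local representatives in the charts of `P` and `N` are smooth. The
domain of a local representative is a relatively open subset of `range I`, a convex
set with nonempty interior, and so it has dense interior. -/
def IsSmoothMap {V : Type*} [NormedAddCommGroup V] [NormedSpace ℝ V] {H : Type*}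
    [TopologicalSpace H] (I : ModelWithCorners ℝ V H)
    {P : Type*} [TopologicalSpace P] [ChartedSpace H P]
    {ι : Type*} {E : ι → Type*} [∀ i, AddCommGroup (E i)] [∀ i, Module ℝ (E i)]
    [∀ i, TopologicalSpace (E i)] {N : Type*} [TopologicalSpace N]
    (𝒜 : LCAtlas E N) (f : P → N) : Prop :=
  Continuous f ∧ ∀ e ∈ atlas H P, ∀ i,
    LCSmoothOn (𝒜.chart i ∘ f ∘ (e.extend I).symm)
      ((e.extend I).target ∩ (e.extend I).symm ⁻¹' (f ⁻¹' (𝒜.chart i).source))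

-- The engine is averaging in a chart. Let `F` send a compact set `K` into one chart `φ` of the
-- target. With a finite smooth partition of unity `ρ` on `K` and sample points `y`, the combination
-- `∑ ρ_y(x) φ(F y)` is smooth, because its vectors are constant and its coefficients are smooth. If
-- `ρ` is fine enough, it differs from `φ(F x)` by an element of a prescribed convex neighbourhood
-- of `0`. This is where local convexity of the model spaces enters. A cutoff interpolates between
-- the average and `F`. Where `F` was already smooth the interpolation is smooth, so no smoothness
-- is lost (`exists_smoothing_of_isCompact`).
--
-- A connected paracompact `M` is `σ`-compact, so a closed set can be treated by countably many such
-- corrections, supported in a locally finite family of compact sets. Near each point only finitely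
-- many of them act, so the sequence stabilizes. The outcome is the relative theorem
-- `exists_smoothing`: a map can be smoothed near a closed set while staying fixed on a disjoint
-- closed set.
--
-- Both claims are this theorem on `[0,1] × M`. For existence, smooth the constant homotopy away
-- from time `0` and take a later slice. For homotopies, make the given one stationary near both
-- ends and smooth it in the middle.
--
-- The calculus underneath is done with `BastianiOn`, a recursion on the tangent map suited to
-- induction and the chain rule. It is shown equivalent, over all finite orders, to the existence of
-- the tower `dⁿf`, by means of the multilinearity of `dⁿf(x)`.

universe u v

/-!
## Directional derivatives in locally convex spaces
-/

section DirectionalDeriv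

variable {X Y : Type*} [AddCommGroup X] [Module ℝ X] [AddCommGroup Y] [Module ℝ Y]
  [TopologicalSpace Y]

theorem HasDirectionalDeriv.unique [T2Space Y] {f : X → Y} {y y' : Y} {x v : X}
    (h : HasDirectionalDeriv f y x v) (h' : HasDirectionalDeriv f y' x v) : y = y' :=
  tendsto_nhds_unique h h'

theorem tendsto_add_smul_nhdsNE [TopologicalSpace X] [ContinuousAdd X] [ContinuousSMul ℝ X]
    (x v : X) : Tendsto (fun h : ℝ => x + h • v) (𝓝[≠] 0) (𝓝 x) := by
  have : Continuous fun h : ℝ => x + h • v := by fun_prop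
  simpa using (this.tendsto 0).mono_left nhdsWithin_le_nhds

theorem HasDirectionalDeriv.congr_of_eventuallyEq [TopologicalSpace X] [ContinuousAdd X]
    [ContinuousSMul ℝ X] {f g : X → Y} {y : Y} {x v : X}
    (h : HasDirectionalDeriv f y x v) (hfg : f =ᶠ[𝓝 x] g) : HasDirectionalDeriv g y x v := by
  refine Tendsto.congr' ?_ h
  filter_upwards [(tendsto_add_smul_nhdsNE x v).eventually hfg] with t ht
  rw [ht, hfg.eq_of_nhds]

theorem HasDirectionalDeriv.tendsto [TopologicalSpace X] [ContinuousAdd Y] [ContinuousSMul ℝ Y]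
    {f : X → Y} {y : Y} {x v : X} (h : HasDirectionalDeriv f y x v) :
    Tendsto (fun t : ℝ => f (x + t • v)) (𝓝[≠] 0) (𝓝 (f x)) := by
  have h1 : Tendsto (fun t : ℝ => t) (𝓝[≠] 0) (𝓝 0) := nhdsWithin_le_nhds
  have h2 := (h1.smul h).add_const (f x)
  rw [zero_smul, zero_add] at h2
  refine h2.congr' ?_
  filter_upwards [self_mem_nhdsWithin] with t ht
  rw [smul_smul, mul_inv_cancel₀ ht, one_smul, sub_add_cancel]

theorem HasDirectionalDeriv.hasDerivAt_comp_line [TopologicalSpace X] [IsTopologicalAddGroup Y]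
    [ContinuousSMul ℝ Y] {f : X → Y} {y : Y} {x v : X} {s : ℝ} (l : Y →L[ℝ] ℝ)
    (h : HasDirectionalDeriv f y (x + s • v) v) :
    HasDerivAt (fun t : ℝ => l (f (x + t • v))) (l y) s := by
  rw [hasDerivAt_iff_tendsto_slope_zero]
  refine ((l.continuous.tendsto y).comp h).congr fun t => ?_
  simp [add_smul, add_assoc]

/-- A form of the mean value inequality: if all directional derivatives along a segment lie in a
closed convex set, so does the difference quotient. -/
theorem inv_smul_sub_mem_of_hasDirectionalDeriv [TopologicalSpace X] [IsTopologicalAddGroup Y]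
    [ContinuousSMul ℝ Y] [LocallyConvexSpace ℝ Y] {f : X → Y} {f' : X → Y} {x v : X} {h : ℝ}
    (hh : h ≠ 0) {C : Set Y} (hC : Convex ℝ C) (hC' : IsClosed C)
    (hd : ∀ s ∈ Icc (0 : ℝ) 1, HasDirectionalDeriv f (f' (x + (s * h) • v)) (x + (s * h) • v) v)
    (hmem : ∀ s ∈ Icc (0 : ℝ) 1, f' (x + (s * h) • v) ∈ C) :
    h⁻¹ • (f (x + h • v) - f x) ∈ C := by
  -- Hahn–Banach separates the quotient strictly from `C` by a functional `l`. The scalar mean value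
  -- theorem makes its `l`-value equal to that of some derivative in `C`.
  by_contra hn
  obtain ⟨l, c, hl, hc⟩ := geometric_hahn_banach_closed_point hC hC' hn
  have hder : ∀ s ∈ Icc (0 : ℝ) 1, HasDerivAt (fun s : ℝ => l (f (x + (s * h) • v)))
      (l (f' (x + (s * h) • v)) * h) s := fun s hs =>
    HasDerivAt.comp (h := fun s => s * h) s ((hd s hs).hasDerivAt_comp_line l)
      (by simpa using (hasDerivAt_id s).mul_const h)
  obtain ⟨s, hs, hs'⟩ := exists_hasDerivAt_eq_slope _ _ (zero_lt_one' ℝ)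
    (fun s hs => (hder s hs).continuousAt.continuousWithinAt)
    (fun s hs => hder s (Ioo_subset_Icc_self hs))
  have := hl _ (hmem s (Ioo_subset_Icc_self hs))
  have h1 : l (h⁻¹ • (f (x + h • v) - f x)) = l (f' (x + (s * h) • v)) := by
    rw [map_smul, map_sub, smul_eq_mul]
    simp only [one_mul, zero_mul, zero_smul, add_zero, sub_zero, div_one] at hs'
    rw [← hs']
    field_simp
  linarith

/-- If the directional derivatives of `f` exist near `x` and are continuous at `(x, w)`, then the
difference quotients converge jointly in base point, direction and step. -/
theorem tendsto_inv_smul_sub [TopologicalSpace X] [ContinuousAdd X] [ContinuousSMul ℝ X]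
    [IsTopologicalAddGroup Y] [ContinuousSMul ℝ Y] [LocallyConvexSpace ℝ Y]
    {f : X → Y} {f' : X × X → Y} {x w : X}
    (hd : ∀ᶠ z in 𝓝 x, ∀ v, HasDirectionalDeriv f (f' (z, v)) z v)
    (hc : ContinuousAt f' (x, w)) {α : Type*} {F : Filter α} {a b : α → X} {h : α → ℝ}
    (ha : Tendsto a F (𝓝 x)) (hb : Tendsto b F (𝓝 w)) (hh : Tendsto h F (𝓝[≠] 0)) :
    Tendsto (fun i => (h i)⁻¹ • (f (a i + h i • b i) - f (a i))) F (𝓝 (f' (x, w))) := by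
  refine tendsto_def.2 fun S hS => ?_
  obtain ⟨C₁, hC₁, hC₁c, hC₁S⟩ := exists_mem_nhds_isClosed_subset hS
  obtain ⟨C₂, ⟨hC₂, hC₂c⟩, hC₂C⟩ :=
    (LocallyConvexSpace.convex_basis (𝕜 := ℝ) (f' (x, w))).mem_iff.1 hC₁
  have hCS : closure C₂ ⊆ S := (closure_minimal hC₂C hC₁c).trans hC₁S
  have hev := hc.eventually (mem_of_superset hC₂ subset_closure)
  rw [nhds_prod_eq] at hev
  obtain ⟨p, hp, q, hq, hpq⟩ := eventually_prod_iff.1 hev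
  have hcont : Continuous fun r : X × X × ℝ => r.1 + r.2.2 • r.2.1 := by fun_prop
  have h0 : Tendsto (fun r : X × X × ℝ => r.1 + r.2.2 • r.2.1) (𝓝 (x, w, 0)) (𝓝 x) := by
    simpa using hcont.tendsto (x, w, 0)
  have hev2 := h0.eventually (hp.and hd)
  rw [nhds_prod_eq, nhds_prod_eq] at hev2
  obtain ⟨p1, hp1, q1, hq1, hpq1⟩ := eventually_prod_iff.1 hev2
  obtain ⟨p2, hp2, q2, hq2, hpq2⟩ := eventually_prod_iff.1 hq1
  obtain ⟨δ, hδ, hδ'⟩ := Metric.eventually_nhds_iff.1 hq2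
  have hh0 : ∀ᶠ i in F, h i ≠ 0 := hh.eventually self_mem_nhdsWithin
  have hhδ : ∀ᶠ i in F, dist (h i) 0 < δ :=
    (hh.mono_right nhdsWithin_le_nhds).eventually (Metric.ball_mem_nhds _ hδ)
  filter_upwards [ha.eventually hp1, hb.eventually hp2, hb.eventually hq, hh0, hhδ]
    with i h1 h2 h3 h4 h5
  have key : ∀ s ∈ Icc (0 : ℝ) 1, p (a i + (s * h i) • b i) ∧
      ∀ v, HasDirectionalDeriv f (f' (a i + (s * h i) • b i, v)) (a i + (s * h i) • b i) v := by
    intro s hs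
    refine hpq1 h1 (y := (b i, s * h i)) (hpq2 h2 (hδ' ?_))
    rw [Real.dist_eq, sub_zero] at h5 ⊢
    rw [abs_mul, abs_of_nonneg hs.1]
    exact (mul_le_of_le_one_left (abs_nonneg _) hs.2).trans_lt h5
  exact hCS (inv_smul_sub_mem_of_hasDirectionalDeriv (f' := fun z => f' (z, b i)) h4 hC₂c.closure
    isClosed_closure (fun s hs => (key s hs).2 _) (fun s hs => hpq (key s hs).1 h3))

end DirectionalDeriv

/-!
## Smoothness by recursion on the tangent map
-/

/-- `f` is of class `C^n` on `A` in the sense of Bastiani: `f` is continuous on `A` and, for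
`n > 0`, its directional derivatives on the interior of `A` extend to a map on `A × X` which is of
class `C^(n-1)`. -/
def BastianiOn {Y : Type v} [AddCommGroup Y] [Module ℝ Y] [TopologicalSpace Y] :
    ℕ → ∀ {X : Type u} [AddCommGroup X] [Module ℝ X] [TopologicalSpace X], (X → Y) → Set X → Prop
  | 0, _, _, _, _, f, A => ContinuousOn f A
  | n + 1, X, _, _, _, f, A => ContinuousOn f A ∧ ∃ f' : X × X → Y,
      (∀ x ∈ interior A, ∀ v, HasDirectionalDeriv f (f' (x, v)) x v) ∧
        BastianiOn n f' (A ×ˢ (univ : Set X))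

theorem prod_univ_subset_closure_interior {X Z : Type*} [TopologicalSpace X] [TopologicalSpace Z]
    {A : Set X} (hA : A ⊆ closure (interior A)) :
    A ×ˢ (univ : Set Z) ⊆ closure (interior (A ×ˢ (univ : Set Z))) := by
  rw [interior_prod_eq, closure_prod_eq, interior_univ, closure_univ]
  exact prod_mono_left hA

theorem inter_subset_closure_interior {X : Type*} [TopologicalSpace X] {A U : Set X}
    (hA : A ⊆ closure (interior A)) (hU : IsOpen U) :
    A ∩ U ⊆ closure (interior (A ∩ U)) := by
  rw [interior_inter, hU.interior_eq]
  exact fun x hx => (mem_closure_iff_nhds.2 fun t ht => by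
    simpa [inter_assoc, inter_comm, inter_left_comm] using
      mem_closure_iff_nhds.1 (hA hx.1) _ (inter_mem ht (hU.mem_nhds hx.2)))

/-! ### Permanence properties and the chain rule for Bastiani classes. -/

namespace BastianiOn

section Basic

variable {X : Type u} [AddCommGroup X] [Module ℝ X] [TopologicalSpace X]
  {Y : Type v} [AddCommGroup Y] [Module ℝ Y] [TopologicalSpace Y]

theorem continuousOn {n : ℕ} {f : X → Y} {A : Set X} (h : BastianiOn n f A) :
    ContinuousOn f A := by
  cases n
  exacts [h, h.1]

theorem mono {n : ℕ} {f : X → Y} {A B : Set X} (h : BastianiOn n f A) (hBA : B ⊆ A) :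
    BastianiOn n f B := by
  induction n generalizing X with
  | zero => exact ContinuousOn.mono h hBA
  | succ n ih =>
    obtain ⟨h0, f', hf', h1⟩ := h
    exact ⟨h0.mono hBA, f', fun x hx => hf' x (interior_mono hBA hx),
      ih h1 (prod_mono_left hBA)⟩

theorem congr [ContinuousAdd X] [ContinuousSMul ℝ X] {n : ℕ} {f g : X → Y} {A : Set X}
    (h : BastianiOn n f A) (hfg : EqOn f g A) : BastianiOn n g A := by
  cases n with
  | zero => exact ContinuousOn.congr h hfg.symm
  | succ n =>
    obtain ⟨h0, f', hf', h1⟩ := h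
    refine ⟨h0.congr hfg.symm, f', fun x hx v => (hf' x hx v).congr_of_eventuallyEq ?_, h1⟩
    filter_upwards [mem_interior_iff_mem_nhds.1 hx] with z hz using hfg hz

theorem const (n : ℕ) (c : Y) (A : Set X) : BastianiOn n (fun _ => c) A := by
  induction n generalizing X c with
  | zero => exact continuousOn_const
  | succ n ih =>
    exact ⟨continuousOn_const, fun _ => 0, fun x _ v => by
      simpa [HasDirectionalDeriv] using tendsto_const_nhds, ih _ _⟩

theorem clm (n : ℕ) (L : X →L[ℝ] Y) (A : Set X) : BastianiOn n L A := by
  induction n generalizing X with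
  | zero => exact L.continuous.continuousOn
  | succ n ih =>
    refine ⟨L.continuous.continuousOn, L.comp (ContinuousLinearMap.snd ℝ X X), fun x _ v => ?_,
      ih _ _⟩
    refine Tendsto.congr' (f₁ := fun _ => L v) ?_ tendsto_const_nhds
    filter_upwards [self_mem_nhdsWithin] with h hh
    simp [smul_smul, inv_mul_cancel₀ hh]

/-- Limits are unique on the interior, and density of the interior carries the equality to boundary
points by continuity. -/
theorem eqOn_deriv [T2Space Y] {f : X → Y} {f' g' : X × X → Y}
    {A : Set X} (hA : A ⊆ closure (interior A))
    (hf : ∀ x ∈ interior A, ∀ v, HasDirectionalDeriv f (f' (x, v)) x v)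
    (hg : ∀ x ∈ interior A, ∀ v, HasDirectionalDeriv f (g' (x, v)) x v)
    (hf' : ContinuousOn f' (A ×ˢ (univ : Set X))) (hg' : ContinuousOn g' (A ×ˢ (univ : Set X))) :
    EqOn f' g' (A ×ˢ (univ : Set X)) := by
  have h1 : EqOn f' g' (interior A ×ˢ (univ : Set X)) := fun p hp =>
    (hf p.1 hp.1 p.2).unique (hg p.1 hp.1 p.2)
  refine h1.of_subset_closure hf' hg' (prod_mono_left interior_subset) ?_
  rw [closure_prod_eq, closure_univ]
  exact prod_mono_left hA

/-- The local derivatives glue: on overlaps `eqOn_deriv` forces them to agree, so the derivative at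
base point `x` may be taken from the neighbourhood chosen for `x`. -/
theorem of_locally [ContinuousAdd X] [ContinuousSMul ℝ X] [T2Space Y] {n : ℕ} {f : X → Y}
    {A : Set X} (hA : A ⊆ closure (interior A))
    (h : ∀ x ∈ A, ∃ U, IsOpen U ∧ x ∈ U ∧ BastianiOn n f (A ∩ U)) : BastianiOn n f A := by
  have hcont : ContinuousOn f A := fun x hx => by
    obtain ⟨U, hU, hxU, hf⟩ := h x hx
    exact (continuousWithinAt_inter (hU.mem_nhds hxU)).1 (hf.continuousOn x ⟨hx, hxU⟩)
  induction n generalizing X with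
  | zero => exact hcont
  | succ n ih =>
    choose! U hU hxU hf using h
    choose! hc f' hf' hb using hf
    refine ⟨hcont, fun p => f' p.1 p, fun x hx v => hf' x (interior_subset hx) x ?_ v, ?_⟩
    · rw [interior_inter, (hU x (interior_subset hx)).interior_eq]
      exact ⟨hx, hxU x (interior_subset hx)⟩
    have hloc : ∀ x ∈ A, EqOn (f' x) (fun p => f' p.1 p) ((A ∩ U x) ×ˢ (univ : Set X)) := by
      intro x hx p hp
      have hpA : p.1 ∈ A := hp.1.1
      have hsub1 : A ∩ (U x ∩ U p.1) ⊆ A ∩ U x := fun z hz => ⟨hz.1, hz.2.1⟩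
      have hsub2 : A ∩ (U x ∩ U p.1) ⊆ A ∩ U p.1 := fun z hz => ⟨hz.1, hz.2.2⟩
      exact eqOn_deriv (f := f)
        (inter_subset_closure_interior hA ((hU x hx).inter (hU _ hpA)))
        (fun z hz => hf' x hx z (interior_mono hsub1 hz))
        (fun z hz => hf' _ hpA z (interior_mono hsub2 hz))
        ((hb x hx).continuousOn.mono (prod_mono_left hsub1))
        ((hb _ hpA).continuousOn.mono (prod_mono_left hsub2)) ⟨⟨hp.1.1, hp.1.2, hxU _ hpA⟩, hp.2⟩
    have hloc' : ∀ p ∈ A ×ˢ (univ : Set X), ∃ V, IsOpen V ∧ p ∈ V ∧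
        BastianiOn n (fun p => f' p.1 p) (A ×ˢ (univ : Set X) ∩ V) := by
      intro p hp
      refine ⟨U p.1 ×ˢ univ, (hU _ hp.1).prod isOpen_univ, ⟨hxU _ hp.1, trivial⟩, ?_⟩
      rw [prod_inter_prod, univ_inter]
      exact (hb _ hp.1).congr (hloc _ hp.1)
    refine ih (prod_univ_subset_closure_interior hA) hloc' fun p hp => ?_
    obtain ⟨V, hV, hpV, hfV⟩ := hloc' p hp
    exact (continuousWithinAt_inter (hV.mem_nhds hpV)).1 (hfV.continuousOn p ⟨hp, hpV⟩)

theorem pair {Z : Type*} [AddCommGroup Z] [Module ℝ Z] [TopologicalSpace Z] {n : ℕ}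
    {f : X → Y} {g : X → Z} {A : Set X} (hf : BastianiOn n f A) (hg : BastianiOn n g A) :
    BastianiOn n (fun x => (f x, g x)) A := by
  induction n generalizing X with
  | zero => exact ContinuousOn.prodMk hf hg
  | succ n ih =>
    obtain ⟨hf0, f', hf', hf1⟩ := hf
    obtain ⟨hg0, g', hg', hg1⟩ := hg
    exact ⟨hf0.prodMk hg0, fun p => (f' p, g' p),
      fun x hx v => (hf' x hx v).prodMk_nhds (hg' x hx v), ih hf1 hg1⟩

theorem of_succ {n : ℕ} {f : X → Y} {A : Set X} (h : BastianiOn (n + 1) f A) :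
    BastianiOn n f A := by
  induction n generalizing X with
  | zero => exact h.1
  | succ n ih =>
    obtain ⟨hf0, f', hf', hf1⟩ := h
    exact ⟨hf0, f', hf', ih hf1⟩

/-- Difference quotients of `f ∘ L` along `v` are those of `f` along `L v`, so no chain rule or
local convexity is needed. Interior must go to interior since derivatives are prescribed only there.
-/
theorem comp_clm {Z : Type*} [AddCommGroup Z] [Module ℝ Z] [TopologicalSpace Z] {n : ℕ}
    {f : X → Y} {A : Set X} (hf : BastianiOn n f A) (L : Z →L[ℝ] X) {B : Set Z}
    (hBA : MapsTo L B A) (hBA' : MapsTo L (interior B) (interior A)) :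
    BastianiOn n (fun z => f (L z)) B := by
  induction n generalizing X Z with
  | zero => exact ContinuousOn.comp hf L.continuous.continuousOn hBA
  | succ n ih =>
    obtain ⟨hf0, f', hf', hf1⟩ := hf
    refine ⟨hf0.comp L.continuous.continuousOn hBA, fun p => f' (L p.1, L p.2), fun x hx v => ?_,
      ih hf1 (L.prodMap L) (fun p hp => ⟨hBA hp.1, trivial⟩) ?_⟩
    · simpa [HasDirectionalDeriv] using hf' (L x) (hBA' hx) (L v)
    · rw [interior_prod_eq, interior_prod_eq, interior_univ, interior_univ]
      exact fun p hp => ⟨hBA' hp.1, trivial⟩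

end Basic

section Comp

variable {X : Type u} [AddCommGroup X] [Module ℝ X] [TopologicalSpace X] [ContinuousAdd X]
  [ContinuousSMul ℝ X]
  {E : Type*} [AddCommGroup E] [Module ℝ E] [TopologicalSpace E] [IsTopologicalAddGroup E]
  [ContinuousSMul ℝ E]
  {Y : Type v} [AddCommGroup Y] [Module ℝ Y] [TopologicalSpace Y]
  [IsTopologicalAddGroup Y] [ContinuousSMul ℝ Y] [LocallyConvexSpace ℝ Y]

/-- The chain rule. -/
theorem comp {n : ℕ} {f : E → Y} {B : Set E} {g : X → E} {A : Set X} (hf : BastianiOn n f B)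
    (hg : BastianiOn n g A) (hAB : MapsTo g A B) (hAB' : MapsTo g (interior A) (interior B)) :
    BastianiOn n (f ∘ g) A := by
  induction n generalizing X E with
  | zero => exact ContinuousOn.comp hf hg hAB
  | succ n ih =>
    have hgn := hg.of_succ
    obtain ⟨hf0, f', hf', hf1⟩ := hf
    obtain ⟨hg0, g', hg', hg1⟩ := hg
    refine ⟨hf0.comp hg0 hAB, f' ∘ fun p => (g p.1, g' p), fun x hx v => ?_, ?_⟩
    -- Write `g (x + h • v) = g x + h • b h` with `b h` the difference quotient of `g`. The
    -- direction then varies with `h`, which joint convergence allows.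
    · have h1 := tendsto_inv_smul_sub (f := f) (f' := f') (x := g x) (w := g' (x, v))
        (a := fun _ : ℝ => g x) (b := fun h : ℝ => h⁻¹ • (g (x + h • v) - g x)) (h := fun h => h)
        (F := 𝓝[≠] 0)
        (mem_of_superset (isOpen_interior.mem_nhds (hAB' hx)) hf')
        (hf1.continuousOn.continuousAt (prod_mem_nhds (mem_interior_iff_mem_nhds.1 (hAB' hx))
          univ_mem)) tendsto_const_nhds (hg' x hx v) tendsto_id
      refine h1.congr' ?_
      filter_upwards [self_mem_nhdsWithin] with h hh
      rw [smul_smul, mul_inv_cancel₀ hh, one_smul, add_sub_cancel]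
      rfl
    · refine ih hf1 (pair (hgn.comp_clm (ContinuousLinearMap.fst ℝ X X) (fun p hp => hp.1) ?_)
        hg1) (fun p hp => ⟨hAB hp.1, trivial⟩) ?_
      · rw [interior_prod_eq]
        exact fun p hp => hp.1
      · rw [interior_prod_eq, interior_prod_eq, interior_univ, interior_univ]
        exact fun p hp => ⟨hAB' hp.1, trivial⟩

end Comp

section Algebra

variable {X : Type u} [AddCommGroup X] [Module ℝ X] [TopologicalSpace X] [IsTopologicalAddGroup X]
  [ContinuousSMul ℝ X]
  {Y : Type v} [AddCommGroup Y] [Module ℝ Y] [TopologicalSpace Y]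
  [IsTopologicalAddGroup Y] [ContinuousSMul ℝ Y] [LocallyConvexSpace ℝ Y]

theorem clm_comp {Z : Type*} [AddCommGroup Z] [Module ℝ Z] [TopologicalSpace Z]
    [IsTopologicalAddGroup Z] [ContinuousSMul ℝ Z] {n : ℕ} {f : X → Z} {A : Set X}
    (L : Z →L[ℝ] Y) (hf : BastianiOn n f A) :
    BastianiOn n (fun x => L (f x)) A :=
  (clm n L univ).comp hf (fun _ _ => trivial) (by simp [MapsTo])

theorem add {n : ℕ} {f g : X → Y} {A : Set X} (hf : BastianiOn n f A) (hg : BastianiOn n g A) :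
    BastianiOn n (fun x => f x + g x) A :=
  clm_comp (ContinuousLinearMap.fst ℝ Y Y + ContinuousLinearMap.snd ℝ Y Y) (hf.pair hg)

theorem sub {n : ℕ} {f g : X → Y} {A : Set X} (hf : BastianiOn n f A) (hg : BastianiOn n g A) :
    BastianiOn n (fun x => f x - g x) A :=
  clm_comp (ContinuousLinearMap.fst ℝ Y Y - ContinuousLinearMap.snd ℝ Y Y) (hf.pair hg)

theorem sum {ι : Type*} {n : ℕ} {f : ι → X → Y} {A : Set X} (s : Finset ι)
    (hf : ∀ i ∈ s, BastianiOn n (f i) A) : BastianiOn n (fun x => ∑ i ∈ s, f i x) A := by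
  classical
  induction s using Finset.induction_on with
  | empty => simpa using const n (0 : Y) A
  | insert i s hi ih =>
    simp only [Finset.sum_insert hi]
    exact (hf i (Finset.mem_insert_self i s)).add
      (ih fun j hj => hf j (Finset.mem_insert_of_mem hj))

/-- By the product rule the derivative is a sum of two copies of scalar multiplication precomposed
with linear maps, so the induction closes. -/
theorem smul_univ (n : ℕ) : BastianiOn n (fun p : ℝ × Y => p.1 • p.2) univ := by
  induction n with
  | zero => exact continuous_smul.continuousOn
  | succ n ih =>
    refine ⟨continuous_smul.continuousOn, fun q => q.2.1 • q.1.2 + q.1.1 • q.2.2, fun p _ v => ?_,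
      ?_⟩
    · have h1 : Continuous fun h : ℝ => v.1 • (p.2 + h • v.2) + p.1 • v.2 := by fun_prop
      have h2 := (h1.tendsto 0).mono_left (nhdsWithin_le_nhds (s := {0}ᶜ))
      simp only [zero_smul, add_zero] at h2
      refine h2.congr' ?_
      filter_upwards [self_mem_nhdsWithin] with h hh
      have : (p.1 + h • v.1) • (p.2 + h • v.2) - p.1 • p.2 =
          h • (v.1 • (p.2 + h • v.2) + p.1 • v.2) := by
        simp only [smul_eq_mul]
        module
      simp only [Prod.fst_add, Prod.smul_fst, Prod.snd_add, Prod.smul_snd]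
      rw [this, smul_smul, inv_mul_cancel₀ hh, one_smul]
    · rw [univ_prod_univ]
      let a : (ℝ × Y) × (ℝ × Y) →L[ℝ] ℝ × Y := ContinuousLinearMap.fst ℝ (ℝ × Y) (ℝ × Y)
      let b : (ℝ × Y) × (ℝ × Y) →L[ℝ] ℝ × Y := ContinuousLinearMap.snd ℝ (ℝ × Y) (ℝ × Y)
      exact (ih.comp_clm (((ContinuousLinearMap.fst ℝ ℝ Y).comp b).prod
        ((ContinuousLinearMap.snd ℝ ℝ Y).comp a)) (fun _ _ => trivial) (by simp [MapsTo])).add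
        (ih.comp_clm (((ContinuousLinearMap.fst ℝ ℝ Y).comp a).prod
        ((ContinuousLinearMap.snd ℝ ℝ Y).comp b)) (fun _ _ => trivial) (by simp [MapsTo]))

theorem smul {n : ℕ} {c : X → ℝ} {f : X → Y} {A : Set X} (hc : BastianiOn n c A)
    (hf : BastianiOn n f A) : BastianiOn n (fun x => c x • f x) A :=
  (smul_univ n).comp (hc.pair hf) (fun _ _ => trivial) (by simp [MapsTo])

end Algebra

end BastianiOn

/-- Bridges to Mathlib's calculus, so that partitions of unity and cutoffs can be used. The map `(x,
v) ↦ fderivWithin ℝ f A x v` is again smooth on a set of unique differentiability. -/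
theorem ContDiffOn.bastianiOn {V : Type u} [NormedAddCommGroup V] [NormedSpace ℝ V] {W : Type v}
    [NormedAddCommGroup W] [NormedSpace ℝ W] {f : V → W} {A : Set V} (hf : ContDiffOn ℝ ∞ f A)
    (hA : UniqueDiffOn ℝ A) (n : ℕ) : BastianiOn n f A := by
  induction n generalizing V with
  | zero => exact hf.continuousOn
  | succ n ih =>
    refine ⟨hf.continuousOn, fun p => fderivWithin ℝ f A p.1 p.2, fun x hx v => ?_, ?_⟩
    · have hxA := mem_interior_iff_mem_nhds.1 hx
      have h1 : HasFDerivAt f (fderivWithin ℝ f A x) x :=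
        ((hf.differentiableOn (by simp)) x (interior_subset hx)).hasFDerivWithinAt.hasFDerivAt hxA
      have h2 := (h1.hasLineDerivAt v).tendsto_slope_zero
      exact h2
    · refine ih ?_ (hA.prod uniqueDiffOn_univ)
      have h1 : ContDiffOn ℝ ∞ (fderivWithin ℝ f A) A := hf.fderivWithin hA (by simp)
      exact (h1.comp contDiffOn_fst fun p hp => hp.1).clm_apply contDiffOn_snd

/-! ### Multilinearity of the iterated differentials. -/

section Linearity

variable {X Y : Type*} [AddCommGroup X] [Module ℝ X] [AddCommGroup Y] [Module ℝ Y]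
  [TopologicalSpace Y]

theorem HasDirectionalDeriv.smul [ContinuousConstSMul ℝ Y] {f : X → Y} {y : Y} {x v : X}
    (h : HasDirectionalDeriv f y x v) (c : ℝ) : HasDirectionalDeriv f (c • y) x (c • v) := by
  rcases eq_or_ne c 0 with rfl | hc
  · simpa [HasDirectionalDeriv] using tendsto_const_nhds
  have h1 : Tendsto (fun t : ℝ => t * c) (𝓝[≠] 0) (𝓝[≠] 0) := by
    refine tendsto_nhdsWithin_iff.2 ⟨?_, ?_⟩
    · have : Continuous fun t : ℝ => t * c := by fun_prop
      simpa using (this.tendsto 0).mono_left nhdsWithin_le_nhds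
    · filter_upwards [self_mem_nhdsWithin] with t ht using mul_ne_zero ht hc
  refine ((Tendsto.comp h h1).const_smul c).congr' ?_
  filter_upwards [self_mem_nhdsWithin] with t ht
  simp only [Function.comp_apply, smul_smul]
  rw [mul_inv, mul_comm, mul_assoc, inv_mul_cancel₀ hc, mul_one]

variable [TopologicalSpace X] [ContinuousAdd X] [ContinuousSMul ℝ X] [IsTopologicalAddGroup Y]
  [ContinuousSMul ℝ Y]

/-- Split the increment `t • (v + w)` into a step along `v` followed by a step along `w` from the
moved point `x + t • v`. Continuity of the derivative absorbs the moving base point. -/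
theorem directionalDeriv_add_direction [LocallyConvexSpace ℝ Y] [T2Space Y]
    {f : X → Y} {f' : X × X → Y} {x : X}
    (hd : ∀ᶠ z in 𝓝 x, ∀ v, HasDirectionalDeriv f (f' (z, v)) z v)
    (hc : ∀ v, ContinuousAt f' (x, v)) (v w : X) : f' (x, v + w) = f' (x, v) + f' (x, w) := by
  refine (hd.self_of_nhds (v + w)).unique ?_
  have h1 := tendsto_inv_smul_sub hd (hc w) (tendsto_add_smul_nhdsNE x v)
    tendsto_const_nhds tendsto_id
  refine (Tendsto.add (hd.self_of_nhds v) h1).congr fun t => ?_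
  rw [id, ← smul_add, smul_add t, ← add_assoc, add_comm (f _ - f _), sub_add_sub_cancel]

end Linearity

namespace IsDifferentialTower

variable {X : Type u} [AddCommGroup X] [Module ℝ X] [TopologicalSpace X]
  {Y : Type v} [AddCommGroup Y] [Module ℝ Y] [TopologicalSpace Y]
  {f : X → Y} {A : Set X} {D : (n : ℕ) → X → (Fin n → X) → Y}

theorem continuousAt (hD : IsDifferentialTower f A D) {n : ℕ} {x : X} (hx : x ∈ interior A)
    (v : Fin n → X) : ContinuousAt (fun p : X × (Fin n → X) => D n p.1 p.2) (x, v) :=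
  (hD.continuousOn n).continuousAt (prod_mem_nhds (mem_interior_iff_mem_nhds.1 hx) univ_mem)

theorem continuousAt_snoc (hD : IsDifferentialTower f A D) {n : ℕ} {x : X} (hx : x ∈ interior A)
    (v : Fin n → X) (w : X) :
    ContinuousAt (fun p : X × X => D (n + 1) p.1 (Fin.snoc (α := fun _ => X) v p.2)) (x, w) := by
  have h1 : Continuous fun p : X × X =>
      (p.1, (Fin.snoc (α := fun _ => X) v p.2 : Fin (n + 1) → X)) := by fun_prop
  exact ContinuousAt.comp (g := fun p : X × (Fin (n + 1) → X) => D (n + 1) p.1 p.2)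
    (f := fun p : X × X => (p.1, (Fin.snoc (α := fun _ => X) v p.2 : Fin (n + 1) → X)))
    (hD.continuousAt hx _) h1.continuousAt

variable [IsTopologicalAddGroup X] [ContinuousSMul ℝ X] [IsTopologicalAddGroup Y]
  [ContinuousSMul ℝ Y] [LocallyConvexSpace ℝ Y] [T2Space Y]

/-- In the last slot this is linearity of a directional derivative in its direction. In the earlier
slots linearity of `D n` passes to the limit of difference quotients. -/
theorem map_update (hD : IsDifferentialTower f A D) (n : ℕ) {x : X} (hx : x ∈ interior A)
    (v : Fin n → X) (j : Fin n) (a b : X) (c : ℝ) :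
    D n x (Function.update v j (c • a + b)) =
      c • D n x (Function.update v j a) + D n x (Function.update v j b) := by
  induction n generalizing x with
  | zero => exact j.elim0
  | succ n ih =>
    have hev : ∀ᶠ z in 𝓝 x, z ∈ interior A := isOpen_interior.mem_nhds hx
    obtain ⟨v, w, rfl⟩ : ∃ (v' : Fin n → X) (w : X), v = Fin.snoc (α := fun _ => X) v' w :=
      ⟨Fin.init v, v (Fin.last n), (Fin.snoc_init_self v).symm⟩
    induction j using Fin.lastCases with
    | last =>
      simp only [Fin.update_snoc_last]
      rw [directionalDeriv_add_direction (f := fun z => D n z v)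
        (f' := fun p => D (n + 1) p.1 (Fin.snoc (α := fun _ => X) v p.2))
        (hev.mono fun z hz => hD.deriv_eq n z hz v) (hD.continuousAt_snoc hx v)]
      exact congrArg (· + _) ((hD.deriv_eq n x hx v (c • a)).unique
        ((hD.deriv_eq n x hx v a).smul c))
    | cast j =>
      simp only [← Fin.snoc_update]
      refine (hD.deriv_eq n x hx _ w).unique ?_
      refine (((hD.deriv_eq n x hx (Function.update v j a) w).const_smul c).add
        (hD.deriv_eq n x hx (Function.update v j b) w)).congr' ?_
      filter_upwards [(tendsto_add_smul_nhdsNE x w).eventually hev] with t ht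
      rw [ih ht, ih hx]
      module

/-- The iterated differential at an interior point as a multilinear map. -/
noncomputable def multilinearMap (hD : IsDifferentialTower f A D) (n : ℕ) {x : X}
    (hx : x ∈ interior A) : MultilinearMap ℝ (fun _ : Fin n => X) Y :=
  have hz : ∀ (v : Fin n → X) (i : Fin n), D n x (Function.update v i 0) = 0 := fun v i => by
    simpa using hD.map_update n hx v i 0 0 1
  .mk' (D n x)
    (fun v i a b => by simpa using hD.map_update n hx v i a b 1)
    (fun v i c a => by simpa [hz] using hD.map_update n hx v i a 0 c)

/-- Expand `D n (x + t • w) (v + t • u)` by multilinearity. Terms with at least two entries from `u`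
carry a factor `t ^ 2` and vanish after division by `t`. -/
theorem hasDirectionalDeriv_uncurry (hD : IsDifferentialTower f A D) (n : ℕ) {x : X}
    (hx : x ∈ interior A) (v : Fin n → X) (w : X) (u : Fin n → X) :
    HasDirectionalDeriv (fun p : X × (Fin n → X) => D n p.1 p.2)
      (D (n + 1) x (Fin.snoc (α := fun _ => X) v w) + ∑ j, D n x (Function.update v j (u j)))
      (x, v) (w, u) := by
  have hev : ∀ᶠ z in 𝓝 x, z ∈ interior A := isOpen_interior.mem_nhds hx
  have hline := tendsto_add_smul_nhdsNE x w
  have h0 : Tendsto (fun t : ℝ => t) (𝓝[≠] 0) (𝓝 0) := nhdsWithin_le_nhds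
  have hlim : ∀ v' : Fin n → X, Tendsto (fun t : ℝ => D n (x + t • w) v') (𝓝[≠] 0)
      (𝓝 (D n x v')) := fun v' => (hD.deriv_eq n x hx v' w).tendsto
  have h1 : Tendsto (fun t : ℝ => ∑ j, D n (x + t • w) (Function.update v j (u j))) (𝓝[≠] 0)
      (𝓝 (∑ j, D n x (Function.update v j (u j)))) := tendsto_finsetSum _ fun j _ => hlim _
  have h2 : Tendsto (fun t : ℝ => ∑ s : Finset (Fin n) with 2 ≤ s.card,
      t ^ (s.card - 1) • D n (x + t • w) (s.piecewise u v)) (𝓝[≠] 0) (𝓝 0) := by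
    have : (0 : Y) = ∑ s : Finset (Fin n) with 2 ≤ s.card,
        (0 : ℝ) ^ (s.card - 1) • D n x (s.piecewise u v) := by
      refine (Finset.sum_eq_zero fun s hs => ?_).symm
      rw [zero_pow, zero_smul]
      have := (Finset.mem_filter.1 hs).2
      omega
    rw [this]
    exact tendsto_finsetSum _ fun s _ => (h0.pow _).smul (hlim _)
  have h3 := ((hD.deriv_eq n x hx v w).add h1).add h2
  rw [add_zero] at h3
  refine h3.congr' ?_
  filter_upwards [hline.eventually hev, self_mem_nhdsWithin] with t ht htne
  have htne : t ≠ 0 := htne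
  have key : D n (x + t • w) (v + t • u) = D n (x + t • w) v +
      t • (∑ j, D n (x + t • w) (Function.update v j (u j))) +
      t • ∑ s : Finset (Fin n) with 2 ≤ s.card,
        t ^ (s.card - 1) • D n (x + t • w) (s.piecewise u v) := by
    have h := (hD.multilinearMap n ht).map_add_eq_map_add_linearDeriv_add v (t • u)
    rw [map_smul, MultilinearMap.linearDeriv_apply] at h
    refine h.trans ?_
    congr 1
    rw [Finset.smul_sum]
    refine Finset.sum_congr rfl fun s hs => ?_
    have hcard := (Finset.mem_filter.1 hs).2
    have h4 := (hD.multilinearMap n ht).map_piecewise_smul (fun _ => t) (s.piecewise u v) s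
    have h5 : s.piecewise (fun i => t • s.piecewise u v i) (s.piecewise u v) =
        s.piecewise (t • u) v := by
      ext i
      by_cases hi : i ∈ s <;> simp [hi]
    rw [h5, Finset.prod_const] at h4
    refine h4.trans ?_
    rw [smul_smul, ← pow_succ', Nat.sub_add_cancel (by omega)]
    rfl
  have key' : D n ((x, v) + t • (w, u)).1 ((x, v) + t • (w, u)).2 =
    D n (x + t • w) (v + t • u) := rfl
  rw [key', key]
  simp only [smul_sub, smul_add, smul_smul, inv_mul_cancel₀ htne, one_smul]
  abel

/-- The derivative of `D k` is built from `D (k + 1)` and `D k` by linear substitutions, so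
induction on `n` works for all `k` at once. -/
theorem bastianiOn_uncurry (hD : IsDifferentialTower f A D) (n k : ℕ) :
    BastianiOn n (fun p : X × (Fin k → X) => D k p.1 p.2) (A ×ˢ (univ : Set (Fin k → X))) := by
  induction n generalizing k with
  | zero => exact hD.continuousOn k
  | succ n ih =>
    refine ⟨hD.continuousOn k, fun q =>
      D (k + 1) q.1.1 (Fin.snoc (α := fun _ => X) q.1.2 q.2.1) +
        ∑ j, D k q.1.1 (Function.update q.1.2 j (q.2.2 j)), ?_, ?_⟩
    · rw [interior_prod_eq]
      exact fun p hp q => hD.hasDirectionalDeriv_uncurry k hp.1 p.2 q.1 q.2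
    · refine BastianiOn.add ?_ (BastianiOn.sum _ fun j _ => ?_)
      · let L : (X × (Fin k → X)) × (X × (Fin k → X)) →L[ℝ] X × (Fin (k + 1) → X) :=
          { toFun := fun q => (q.1.1, Fin.snoc (α := fun _ => X) q.1.2 q.2.1)
            map_add' := fun p q => by
              refine Prod.ext rfl (funext fun i => ?_)
              induction i using Fin.lastCases <;> simp
            map_smul' := fun c q => by
              refine Prod.ext rfl (funext fun i => ?_)
              induction i using Fin.lastCases <;> simp
            cont := by fun_prop }
        refine (ih (k + 1)).comp_clm L (fun q hq => ⟨hq.1.1, trivial⟩) ?_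
        simp only [interior_prod_eq]
        exact fun q hq => ⟨hq.1.1, by simp⟩
      · let L : (X × (Fin k → X)) × (X × (Fin k → X)) →L[ℝ] X × (Fin k → X) :=
          { toFun := fun q => (q.1.1, Function.update q.1.2 j (q.2.2 j))
            map_add' := fun p q => by
              refine Prod.ext rfl (funext fun i => ?_)
              rcases eq_or_ne i j with rfl | hi <;> simp [*]
            map_smul' := fun c q => by
              refine Prod.ext rfl (funext fun i => ?_)
              rcases eq_or_ne i j with rfl | hi <;> simp [*]
            cont := by fun_prop }
        refine (ih k).comp_clm L (fun q hq => ⟨hq.1.1, trivial⟩) ?_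
        simp only [interior_prod_eq]
        exact fun q hq => ⟨hq.1.1, by simp⟩

end IsDifferentialTower

/-! ### Towers of differentials versus Bastiani classes of every order. -/

section Equivalence

variable {X : Type u} [AddCommGroup X] [Module ℝ X] [TopologicalSpace X]
  [IsTopologicalAddGroup X] [ContinuousSMul ℝ X]
  {Y : Type v} [AddCommGroup Y] [Module ℝ Y] [TopologicalSpace Y]
  [T2Space Y] {f : X → Y} {A : Set X}

theorem LCSmoothOn.bastianiOn [IsTopologicalAddGroup Y]
    [ContinuousSMul ℝ Y] [LocallyConvexSpace ℝ Y] (hf : LCSmoothOn f A) (n : ℕ) :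
    BastianiOn n f A := by
  obtain ⟨D, hD⟩ := hf
  have h := (hD.bastianiOn_uncurry n 0).comp_clm
    (ContinuousLinearMap.inl ℝ X (Fin 0 → X)) (B := A) (fun x hx => ⟨hx, trivial⟩)
    (by rw [interior_prod_eq]; exact fun x hx => ⟨hx, by simp⟩)
  exact h.congr fun x hx => hD.zero_eq x hx _

/-- The derivative supplied by each order could a priori differ. Density of the interior shows they
coincide, so one derivative serves all orders. -/
theorem BastianiOn.exists_deriv (hA : A ⊆ closure (interior A))
    (hf : ∀ n, BastianiOn n f A) : ∃ f' : X × X → Y,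
      (∀ x ∈ interior A, ∀ v, HasDirectionalDeriv f (f' (x, v)) x v) ∧
        ∀ n, BastianiOn n f' (A ×ˢ (univ : Set X)) := by
  obtain ⟨_, f', hf', h1⟩ := hf 1
  refine ⟨f', hf', fun n => ?_⟩
  obtain ⟨_, g', hg', h2⟩ := hf (n + 1)
  exact h2.congr (eqOn_deriv hA hg' hf' h2.continuousOn h1.continuousOn)

/-- The next differential is the derivative of the current one in the direction `(w, 0)`, which
moves the base point and freezes the vectors already inserted. -/
theorem lcSmoothOn_of_forall_bastianiOn (hA : A ⊆ closure (interior A))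
    (hf : ∀ n, BastianiOn n f A) : LCSmoothOn f A := by
  let T (k : ℕ) := {g : X × (Fin k → X) → Y // ∀ n, BastianiOn n g (A ×ˢ (univ : Set (Fin k → X)))}
  have step : ∀ (k : ℕ) (g : T k), ∃ g' : T (k + 1), ∀ x ∈ interior A, ∀ (v : Fin k → X) (w : X),
      HasDirectionalDeriv (fun z => g.1 (z, v)) (g'.1 (x, Fin.snoc (α := fun _ => X) v w)) x w := by
    rintro k ⟨g, hg⟩
    obtain ⟨g', hg', hb⟩ := BastianiOn.exists_deriv (prod_univ_subset_closure_interior hA) hg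
    let L : X × (Fin (k + 1) → X) →L[ℝ] (X × (Fin k → X)) × (X × (Fin k → X)) :=
      { toFun := fun p => ((p.1, Fin.init p.2), (p.2 (Fin.last k), 0))
        map_add' := fun p q => by ext <;> simp [Fin.init]
        map_smul' := fun c q => by ext <;> simp [Fin.init]
        cont := by unfold Fin.init; fun_prop }
    refine ⟨⟨fun p => g' (L p), fun n => (hb n).comp_clm L
      (fun q hq => ⟨⟨hq.1, trivial⟩, trivial⟩) ?_⟩, fun x hx v w => ?_⟩
    · simp only [interior_prod_eq]
      exact fun q hq => ⟨⟨hq.1, by simp⟩, by simp⟩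
    · have h := hg' (x, v) (by rw [interior_prod_eq]; exact ⟨hx, by simp⟩) (w, 0)
      have hL : L (x, Fin.snoc (α := fun _ => X) v w) = ((x, v), (w, 0)) := by
        simp [L]
      simpa [HasDirectionalDeriv, hL] using h
  choose next hnext using step
  have h0 : ∀ n, BastianiOn n (fun p : X × (Fin 0 → X) => f p.1)
      (A ×ˢ (univ : Set (Fin 0 → X))) := fun n =>
    (hf n).comp_clm (ContinuousLinearMap.fst ℝ X (Fin 0 → X)) (fun q hq => hq.1)
      (by rw [interior_prod_eq]; exact fun q hq => hq.1)
  let D : (k : ℕ) → T k := fun k => Nat.rec ⟨_, h0⟩ next k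
  exact ⟨fun k x v => (D k).1 (x, v), fun x _ v => rfl, fun k x hx v w => hnext k (D k) x hx v w,
    fun k => ((D k).2 0).continuousOn⟩

end Equivalence

/-!
## Smooth maps on open subsets
-/

section SmoothOn

variable {V : Type*} [NormedAddCommGroup V] [NormedSpace ℝ V] {H : Type*}
  [TopologicalSpace H] (I : ModelWithCorners ℝ V H) {P : Type*} [TopologicalSpace P]

/-- The part of the target of an extended chart corresponding to `W`. -/
def chartDomain (e : OpenPartialHomeomorph P H) (W : Set P) : Set V :=
  (e.extend I).target ∩ (e.extend I).symm ⁻¹' W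

theorem chartDomain_mono (e : OpenPartialHomeomorph P H) {W W' : Set P} (h : W ⊆ W') :
    chartDomain I e W ⊆ chartDomain I e W' :=
  inter_subset_inter_right _ (preimage_mono h)

theorem exists_isOpen_chartDomain_eq (e : OpenPartialHomeomorph P H) {W : Set P} (hW : IsOpen W) :
    ∃ O, IsOpen O ∧ chartDomain I e W = range I ∩ O := by
  refine ⟨I.symm ⁻¹' (e.target ∩ e.symm ⁻¹' W),
    (e.isOpen_inter_preimage_symm hW).preimage I.continuous_symm, ?_⟩
  ext y
  simp only [chartDomain, e.extend_target, mem_inter_iff, mem_preimage]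
  constructor
  · rintro ⟨⟨h1, h2⟩, h3⟩
    exact ⟨h2, h1, h3⟩
  · rintro ⟨h2, h1, h3⟩
    exact ⟨⟨h1, h2⟩, h3⟩

theorem chartDomain_subset_closure_interior (e : OpenPartialHomeomorph P H) {W : Set P}
    (hW : IsOpen W) : chartDomain I e W ⊆ closure (interior (chartDomain I e W)) := by
  obtain ⟨O, hO, h⟩ := exists_isOpen_chartDomain_eq I e hW
  rw [h]
  exact inter_subset_closure_interior I.range_subset_closure_interior hO

theorem interior_chartDomain (e : OpenPartialHomeomorph P H) {W : Set P} (hW : IsOpen W) :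
    interior (chartDomain I e W) = chartDomain I e W ∩ interior (range I) := by
  obtain ⟨O, hO, h⟩ := exists_isOpen_chartDomain_eq I e hW
  rw [h, interior_inter, hO.interior_eq]
  ext y
  exact ⟨fun hy => ⟨⟨interior_subset hy.1, hy.2⟩, hy.1⟩, fun hy => ⟨hy.2, hy.1.2⟩⟩

theorem uniqueDiffOn_chartDomain (e : OpenPartialHomeomorph P H) {W : Set P} (hW : IsOpen W) :
    UniqueDiffOn ℝ (chartDomain I e W) := by
  obtain ⟨O, hO, h⟩ := exists_isOpen_chartDomain_eq I e hW
  rw [h]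
  exact I.uniqueDiffOn.inter hO

variable [ChartedSpace H P]

theorem ContMDiff.bastianiOn_comp_extend_symm [IsManifold I ∞ P] {c : P → ℝ}
    (hc : ContMDiff I 𝓘(ℝ) ∞ c) {e : OpenPartialHomeomorph P H} (he : e ∈ atlas H P) {W : Set P}
    (hW : IsOpen W) (n : ℕ) :
    BastianiOn n (fun y => c ((e.extend I).symm y)) (chartDomain I e W) := by
  refine ContDiffOn.bastianiOn ?_ (uniqueDiffOn_chartDomain I e hW) n
  have h1 := hc.comp_contMDiffOn (contMDiffOn_extend_symm (I := I) (n := ∞)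
    (IsManifold.subset_maximalAtlas he))
  rw [contMDiffOn_iff_contDiffOn] at h1
  refine h1.mono fun y hy => ?_
  have := hy.1
  rw [e.extend_target] at this
  rwa [I.image_eq]

variable {ι : Type*} {E : ι → Type*} [∀ i, AddCommGroup (E i)] [∀ i, Module ℝ (E i)]
  [∀ i, TopologicalSpace (E i)] {N : Type*} [TopologicalSpace N] (𝒜 : LCAtlas E N)

/-- Smoothness of a map from a manifold with corners to a locally convex manifold on a subset. -/
def IsSmoothMapOn (f : P → N) (W : Set P) : Prop :=
  ∀ e ∈ atlas H P, ∀ i, ∀ n,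
    BastianiOn n (𝒜.chart i ∘ f ∘ (e.extend I).symm)
      (chartDomain I e (W ∩ f ⁻¹' (𝒜.chart i).source))

/-- The set of points near which a map is smooth. -/
def smoothLocus (f : P → N) : Set P :=
  {p | ∃ U, IsOpen U ∧ p ∈ U ∧ IsSmoothMapOn I 𝒜 f U}

variable {I 𝒜}

theorem IsSmoothMapOn.mono {f : P → N} {W W' : Set P} (h : IsSmoothMapOn I 𝒜 f W) (hW : W' ⊆ W) :
    IsSmoothMapOn I 𝒜 f W' := fun e he i n =>
  (h e he i n).mono (chartDomain_mono I e (inter_subset_inter_left _ hW))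

theorem IsSmoothMapOn.congr {f g : P → N} {W : Set P} (h : IsSmoothMapOn I 𝒜 f W)
    (hfg : EqOn f g W) : IsSmoothMapOn I 𝒜 g W := by
  intro e he i n
  have : W ∩ f ⁻¹' (𝒜.chart i).source = W ∩ g ⁻¹' (𝒜.chart i).source := by
    ext x
    exact and_congr_right fun hx => by simp [hfg hx]
  rw [← this]
  exact (h e he i n).congr fun y hy => congrArg (𝒜.chart i) (hfg hy.2.1)

theorem smoothLocus_of_eventuallyEq {f g : P → N} {p : P} (h : p ∈ smoothLocus I 𝒜 f)
    (hfg : f =ᶠ[𝓝 p] g) : p ∈ smoothLocus I 𝒜 g := by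
  obtain ⟨U, hU, hpU, hf⟩ := h
  obtain ⟨O, hOs, hO, hpO⟩ := mem_nhds_iff.1 hfg
  exact ⟨U ∩ O, hU.inter hO, ⟨hpU, hpO⟩,
    (hf.mono inter_subset_left).congr fun x hx => hOs hx.2⟩

theorem IsSmoothMapOn.of_subset_smoothLocus [∀ i, T2Space (E i)] {f : P → N} (hf : Continuous f)
    {W : Set P} (hW : IsOpen W) (h : W ⊆ smoothLocus I 𝒜 f) : IsSmoothMapOn I 𝒜 f W := by
  intro e he i n
  have hWo : IsOpen (W ∩ f ⁻¹' (𝒜.chart i).source) :=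
    hW.inter ((𝒜.chart i).open_source.preimage hf)
  refine BastianiOn.of_locally (chartDomain_subset_closure_interior I e hWo) fun y hy => ?_
  obtain ⟨U, hU, hyU, hfU⟩ := h hy.2.1
  obtain ⟨O, hO, hO'⟩ := exists_isOpen_chartDomain_eq I e hU
  refine ⟨O, hO, ?_, (hfU e he i n).mono ?_⟩
  · have : y ∈ chartDomain I e U := ⟨hy.1, hyU⟩
    rw [hO'] at this
    exact this.2
  · rintro z ⟨hz, hzO⟩
    have hzr : z ∈ range I := by
      have := hz.1
      rw [e.extend_target] at this
      exact this.2
    have : z ∈ chartDomain I e U := hO' ▸ ⟨hzr, hzO⟩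
    exact ⟨hz.1, this.2, hz.2.2⟩

variable [∀ i, IsTopologicalAddGroup (E i)] [∀ i, ContinuousSMul ℝ (E i)]
  [∀ i, LocallyConvexSpace ℝ (E i)]

/-- Smoothness may be tested in a single chart of the target. -/
theorem IsSmoothMapOn.of_chart [∀ i, T2Space (E i)] {f : P → N} {W : Set P} (i : ι)
    (hWi : MapsTo f W (𝒜.chart i).source)
    (h : ∀ e ∈ atlas H P, ∀ n,
      BastianiOn n (𝒜.chart i ∘ f ∘ (e.extend I).symm) (chartDomain I e W)) :
    IsSmoothMapOn I 𝒜 f W := by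
  intro e he j n
  have ho : IsOpen ((𝒜.chart i).symm.trans (𝒜.chart j)).source :=
    ((𝒜.chart i).symm.trans (𝒜.chart j)).open_source
  have hmaps : MapsTo (𝒜.chart i ∘ f ∘ (e.extend I).symm)
      (chartDomain I e (W ∩ f ⁻¹' (𝒜.chart j).source))
      ((𝒜.chart i).symm.trans (𝒜.chart j)).source := by
    rintro y ⟨-, hyW, hyj⟩
    rw [OpenPartialHomeomorph.trans_source]
    refine ⟨(𝒜.chart i).map_source (hWi hyW), ?_⟩
    change (𝒜.chart i).symm (𝒜.chart i (f ((e.extend I).symm y))) ∈ (𝒜.chart j).source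
    rwa [(𝒜.chart i).left_inv (hWi hyW)]
  refine (((𝒜.smooth_change i j).bastianiOn n).comp
    ((h e he n).mono (chartDomain_mono I e inter_subset_left)) hmaps ?_).congr ?_
  · rw [ho.interior_eq]
    exact hmaps.mono_left interior_subset
  · rintro y ⟨-, hyW, -⟩
    exact congrArg (𝒜.chart j) ((𝒜.chart i).left_inv (hWi hyW))

theorem isSmoothMap_iff [∀ i, T2Space (E i)] {f : P → N} :
    IsSmoothMap I 𝒜 f ↔ Continuous f ∧ smoothLocus I 𝒜 f = univ := by
  constructor
  · rintro ⟨hc, h⟩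
    refine ⟨hc, eq_univ_of_forall fun p => ⟨univ, isOpen_univ, trivial, fun e he i n => ?_⟩⟩
    rw [univ_inter]
    exact (h e he i).bastianiOn n
  · rintro ⟨hc, h⟩
    refine ⟨hc, fun e he i => ?_⟩
    have hs := IsSmoothMapOn.of_subset_smoothLocus (I := I) (𝒜 := 𝒜) hc isOpen_univ h.ge e he i
    rw [univ_inter] at hs
    exact lcSmoothOn_of_forall_bastianiOn (chartDomain_subset_closure_interior I e
      ((𝒜.chart i).open_source.preimage hc)) hs

end SmoothOn

/-!
## Smoothing on a compact set
-/

section Smoothing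

variable {V : Type*} [NormedAddCommGroup V] [NormedSpace ℝ V] [FiniteDimensional ℝ V] {H : Type*}
  [TopologicalSpace H] {I : ModelWithCorners ℝ V H} {P : Type*} [TopologicalSpace P]
  [ChartedSpace H P] [IsManifold I ∞ P] [T2Space P] [SigmaCompactSpace P]
  {ι : Type*} {E : ι → Type*} [∀ i, AddCommGroup (E i)] [∀ i, Module ℝ (E i)]
  [∀ i, TopologicalSpace (E i)] [∀ i, IsTopologicalAddGroup (E i)] [∀ i, ContinuousSMul ℝ (E i)]
  [∀ i, LocallyConvexSpace ℝ (E i)] [∀ i, T2Space (E i)] {N : Type*} [TopologicalSpace N]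
  {𝒜 : LCAtlas E N}

/-- Around a compact set, small perturbations in a chart stay inside an open neighbourhood of
the graph. -/
theorem exists_convex_nhds_of_isCompact {P' E' N' : Type*} [TopologicalSpace P']
    [TopologicalSpace N'] [AddCommGroup E'] [Module ℝ E'] [TopologicalSpace E']
    [IsTopologicalAddGroup E'] [ContinuousSMul ℝ E'] [LocallyConvexSpace ℝ E']
    (φ : OpenPartialHomeomorph N' E')
    (F : C(P', N')) {Ω : Set (P' × N')} (hΩ : IsOpen Ω) (hF : ∀ x, (x, F x) ∈ Ω) {K : Set P'}
    (hK : IsCompact K) (hKφ : ∀ x ∈ K, F x ∈ φ.source) :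
    ∃ C : Set E', IsOpen C ∧ Convex ℝ C ∧ 0 ∈ C ∧ ∀ x ∈ K, ∀ w ∈ C,
      φ (F x) + w ∈ φ.target ∧ (x, φ.symm (φ (F x) + w)) ∈ Ω := by
  have hO : IsOpen (F ⁻¹' φ.source) := φ.open_source.preimage F.continuous
  have hφF : ContinuousOn (fun x => φ (F x)) (F ⁻¹' φ.source) :=
    φ.continuousOn.comp F.continuous.continuousOn fun x hx => hx
  have h1 : ContinuousOn (fun q : P' × E' => φ (F q.1) + q.2) ((F ⁻¹' φ.source) ×ˢ univ) :=
    (hφF.comp continuousOn_fst fun q hq => hq.1).add continuousOn_snd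
  have hT1 := h1.isOpen_inter_preimage (hO.prod isOpen_univ) φ.open_target
  have h2 : ContinuousOn (fun q : P' × E' => (q.1, φ.symm (φ (F q.1) + q.2)))
      (((F ⁻¹' φ.source) ×ˢ univ) ∩ (fun q : P' × E' => φ (F q.1) + q.2) ⁻¹' φ.target) :=
    continuousOn_fst.prodMk (φ.continuousOn_symm.comp (h1.mono inter_subset_left) fun q hq => hq.2)
  have hT2 := h2.isOpen_inter_preimage hT1 hΩ
  obtain ⟨a, b, -, hb, hKa, h0b, hab⟩ := generalized_tube_lemma hK
    (isCompact_singleton (x := (0 : E'))) hT2 (by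
      rintro ⟨x, w⟩ ⟨hx, hw⟩
      obtain rfl : w = 0 := hw
      have hxs := hKφ x hx
      refine ⟨⟨⟨hxs, trivial⟩, ?_⟩, ?_⟩
      · simpa using φ.map_source hxs
      · simpa [φ.left_inv hxs] using hF x)
  obtain ⟨C, ⟨hC, hCc⟩, hCb⟩ := (LocallyConvexSpace.convex_basis (𝕜 := ℝ) (0 : E')).mem_iff.1
    (hb.mem_nhds (h0b rfl))
  refine ⟨interior C, isOpen_interior, hCc.interior, mem_interior_iff_mem_nhds.2 hC,
    fun x hx w hw => ?_⟩
  have := hab (show (x, w) ∈ a ×ˢ b from ⟨hKa hx, hCb (interior_subset hw)⟩)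
  exact ⟨this.1.2, this.2⟩

/-- In the chart, `F` becomes `φ F + χ δ`, with `δ` the average minus `φ F` on `K`. Where `χ = 1`
only the smooth average remains, and where `χ = 0` only `F` does. Since `C` is convex and contains
`0`, the correction stays in `C`, hence the graph in `Ω`. -/
theorem exists_smoothing_of_isCompact (F : C(P, N)) {Ω : Set (P × N)} (hΩ : IsOpen Ω)
    (hF : ∀ x, (x, F x) ∈ Ω) {K L : Set P} (hK : IsCompact K) (hL : IsClosed L)
    (hLK : L ⊆ interior K) (i : ι) (hKi : ∀ x ∈ K, F x ∈ (𝒜.chart i).source) :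
    ∃ G : C(P, N), (∀ x, (x, G x) ∈ Ω) ∧ (∀ x ∉ K, G x = F x) ∧ L ⊆ smoothLocus I 𝒜 G ∧
      smoothLocus I 𝒜 F ⊆ smoothLocus I 𝒜 G := by
  have : LocallyCompactSpace P := Manifold.locallyCompact_of_finiteDimensional I
  set φ := 𝒜.chart i with hφ
  obtain ⟨C, hCo, hC, hC0, hCΩ⟩ := exists_convex_nhds_of_isCompact φ F hΩ hF hK hKi
  have hφF : ContinuousOn (fun x => φ (F x)) (F ⁻¹' φ.source) :=
    φ.continuousOn.comp F.continuous.continuousOn fun x hx => hx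
  have hO : IsOpen (F ⁻¹' φ.source) := φ.open_source.preimage F.continuous
  -- If `ρ y` is supported in `W y`, only differences lying in `C` are averaged at `x`.
  let W : P → Set P := fun x => F ⁻¹' φ.source ∩ (fun x' => φ (F x) - φ (F x')) ⁻¹' C
  have hW : ∀ x, IsOpen (W x) := fun x =>
    (continuousOn_const.sub hφF).isOpen_inter_preimage hO hCo
  obtain ⟨t, ht, hKt⟩ := hK.elim_nhds_subcover W fun x hx =>
    (hW x).mem_nhds ⟨hKi x hx, by simpa using hC0⟩
  obtain ⟨ρ, hρ⟩ := SmoothPartitionOfUnity.exists_isSubordinate I hK.isClosed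
    (fun x : t => W x) (fun x => hW x) (by
      intro x hx
      obtain ⟨y, hy, hxy⟩ := mem_iUnion₂.1 (hKt hx)
      exact mem_iUnion.2 ⟨⟨y, hy⟩, hxy⟩)
  -- `χ` is constant on open neighbourhoods `S₀` of the complement of `interior K` and `S₁` of `L`.
  -- Thus `interior K` and `S₀` form an open cover on which the two definitions glue.
  obtain ⟨χ, hχ0, hχ1, hχ⟩ := exists_contMDiffMap_zero_one_nhds_of_isClosed I (n := ⊤)
    isOpen_interior.isClosed_compl hL (by rwa [disjoint_compl_left_iff_subset])
  obtain ⟨S₀, hS₀, hKS₀, hχ0⟩ := eventually_nhdsSet_iff_exists.1 hχ0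
  obtain ⟨S₁, hS₁, hLS₁, hχ1⟩ := eventually_nhdsSet_iff_exists.1 hχ1
  let δ : P → E i := fun x => ∑ y : t, ρ y x • (φ (F y) - φ (F x))
  let ψ : P → E i := fun x => φ (F x) + χ x • δ x
  have hsum : ∀ x ∈ K, ∑ y : t, ρ y x = 1 := fun x hx => by
    rw [← finsum_eq_sum_of_fintype]
    exact ρ.sum_eq_one hx
  have hδC : ∀ x ∈ K, χ x • δ x ∈ C := fun x hx => by
    refine hC.smul_mem_of_zero_mem hC0 ?_ (hχ x)
    have := hC.finsum_mem (w := fun y => ρ y x) (z := fun y : t => φ (F y) - φ (F x))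
      (fun y => ρ.nonneg y x) (ρ.sum_eq_one hx)
      (fun y hy => (hρ y (subset_tsupport _ hy)).2)
    rwa [finsum_eq_sum_of_fintype] at this
  have hψt : ∀ x ∈ K, ψ x ∈ φ.target := fun x hx => (hCΩ x hx _ (hδC x hx)).1
  have hKO : interior K ⊆ F ⁻¹' φ.source := fun x hx => hKi x (interior_subset hx)
  have hψc : ContinuousOn ψ (interior K) := by
    have h1 := hφF.mono hKO
    refine h1.add (χ.contMDiff.continuous.continuousOn.smul ?_)
    exact continuousOn_finsetSum _ fun y _ =>
      ((ρ y).contMDiff.continuous.continuousOn).smul (continuousOn_const.sub h1)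
  classical
  let g : P → N := fun x => if x ∈ interior K then φ.symm (ψ x) else F x
  have hgK : ∀ x ∈ interior K, g x = φ.symm (ψ x) := fun x hx => if_pos hx
  have hgS : ∀ x ∈ S₀, g x = F x := fun x hx => by
    by_cases hxK : x ∈ interior K
    · rw [hgK x hxK]
      simp only [ψ, hχ0 x hx, zero_smul, add_zero]
      exact φ.left_inv (hKO hxK)
    · exact if_neg hxK
  have hcover : ∀ x, x ∈ interior K ∨ x ∈ S₀ := fun x => or_iff_not_imp_left.2 fun h => hKS₀ h
  have hgc : Continuous g := by
    refine continuous_iff_continuousAt.2 fun x => ?_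
    rcases hcover x with hx | hx
    · have h1 : ContinuousOn (fun x => φ.symm (ψ x)) (interior K) :=
        φ.continuousOn_symm.comp hψc fun x hx => hψt x (interior_subset hx)
      refine (h1.continuousAt (isOpen_interior.mem_nhds hx)).congr ?_
      filter_upwards [isOpen_interior.mem_nhds hx] with y hy using (hgK y hy).symm
    · refine F.continuous.continuousAt.congr ?_
      filter_upwards [hS₀.mem_nhds hx] with y hy using (hgS y hy).symm
  have hgsource : ∀ x ∈ interior K, g x ∈ φ.source := fun x hx => by
    rw [hgK x hx]
    exact φ.map_target (hψt x (interior_subset hx))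
  have hφg : ∀ x ∈ interior K, φ (g x) = ψ x := fun x hx => by
    rw [hgK x hx]
    exact φ.right_inv (hψt x (interior_subset hx))
  refine ⟨⟨g, hgc⟩, fun x => ?_, fun x hx => if_neg fun h => hx (interior_subset h),
    fun x hx => ?_, fun x hx => ?_⟩
  · change (x, g x) ∈ Ω
    by_cases hx : x ∈ interior K
    · rw [hgK x hx]
      exact (hCΩ x (interior_subset hx) _ (hδC x (interior_subset hx))).2
    · have : g x = F x := if_neg hx
      rw [this]
      exact hF x
  · have ho : IsOpen (S₁ ∩ interior K) := hS₁.inter isOpen_interior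
    refine ⟨S₁ ∩ interior K, ho, ⟨hLS₁ hx, hLK hx⟩,
      IsSmoothMapOn.of_chart i (fun y hy => hgsource y hy.2) fun e he n => ?_⟩
    have h1 : BastianiOn n (fun z => ∑ y : t, ρ y ((e.extend I).symm z) • φ (F y))
        (chartDomain I e (S₁ ∩ interior K)) := BastianiOn.sum _ fun y _ =>
      ((ρ y).contMDiff.bastianiOn_comp_extend_symm I he ho n).smul (BastianiOn.const n _ _)
    refine h1.congr fun z hz => ?_
    have hz1 := hχ1 _ hz.2.1
    have hz2 := hsum _ (interior_subset hz.2.2)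
    change _ = φ (g _)
    rw [hφg _ hz.2.2]
    simp only [ψ, δ, hz1, one_smul, smul_sub, Finset.sum_sub_distrib]
    rw [← Finset.sum_smul, hz2, one_smul, add_sub_cancel]
  · rcases hcover x with hxK | hxS
    · obtain ⟨U, hU, hxU, hFU⟩ := hx
      have ho : IsOpen (U ∩ interior K) := hU.inter isOpen_interior
      refine ⟨U ∩ interior K, ho, ⟨hxU, hxK⟩,
        IsSmoothMapOn.of_chart i (fun y hy => hgsource y hy.2) fun e he n => ?_⟩
      have h0 : BastianiOn n (fun z => φ (F ((e.extend I).symm z)))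
          (chartDomain I e (U ∩ interior K)) :=
        (hFU e he i n).mono (chartDomain_mono I e fun y hy => ⟨hy.1, hKO hy.2⟩)
      have h1 : BastianiOn n (fun z => ψ ((e.extend I).symm z))
          (chartDomain I e (U ∩ interior K)) :=
        h0.add ((χ.contMDiff.bastianiOn_comp_extend_symm I he ho n).smul
          (BastianiOn.sum _ fun y _ =>
            ((ρ y).contMDiff.bastianiOn_comp_extend_symm I he ho n).smul
              ((BastianiOn.const n _ _).sub h0)))
      exact h1.congr fun z hz => (hφg _ hz.2.2).symm
    · refine smoothLocus_of_eventuallyEq hx ?_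
      filter_upwards [hS₀.mem_nhds hxS] with y hy using (hgS y hy).symm

end Smoothing

/-- A connected, locally compact, paracompact Hausdorff space is `σ`-compact. -/
theorem SigmaCompactSpace.of_connected_paracompact (X : Type*) [TopologicalSpace X] [T2Space X]
    [LocallyCompactSpace X] [ParacompactSpace X] [ConnectedSpace X] : SigmaCompactSpace X := by
  choose u hu hxu _ hcu using fun x : X => exists_open_between_and_isCompact_closure
    (isCompact_singleton (x := x)) isOpen_univ (subset_univ _)
  obtain ⟨v, hv, hvc, hvf, hvu⟩ := precise_refinement u hu
    (eq_univ_of_forall fun x => mem_iUnion.2 ⟨x, hxu x rfl⟩)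
  have hcv : ∀ a, IsCompact (closure (v a)) := fun a =>
    (hcu a).of_isClosed_subset isClosed_closure (closure_mono (hvu a))
  obtain ⟨x₀⟩ : Nonempty X := inferInstance
  -- Starting at a point, adjoin the closures of all `v a` that meet the current set. Local
  -- finiteness keeps each stage compact, and the union is clopen.
  let T : ℕ → Set X := fun n => Nat.rec {x₀}
    (fun _ S => ⋃ a ∈ {a | (v a ∩ S).Nonempty}, closure (v a)) n
  have hT : ∀ n, T (n + 1) = ⋃ a ∈ {a | (v a ∩ T n).Nonempty}, closure (v a) := fun _ => rfl
  have hTc : ∀ n, IsCompact (T n) := by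
    intro n
    induction n with
    | zero => exact isCompact_singleton
    | succ n ih =>
      rw [hT]
      exact (hvf.finite_nonempty_inter_compact ih).isCompact_biUnion fun a _ => hcv a
  have hsub : ∀ n a, (v a ∩ T n).Nonempty → v a ⊆ T (n + 1) := fun n a h x hx => by
    rw [hT]
    exact mem_iUnion₂.2 ⟨a, h, subset_closure hx⟩
  have hmem : ∀ x, ∃ a, x ∈ v a := fun x => mem_iUnion.1 (hvc ▸ mem_univ x)
  have hclopen : IsClopen (⋃ n, T n) := by
    constructor
    · refine isOpen_compl_iff.1 (isOpen_iff_mem_nhds.2 fun x hx => ?_)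
      obtain ⟨a, ha⟩ := hmem x
      refine mem_of_superset ((hv a).mem_nhds ha) fun y hy hyT => hx ?_
      obtain ⟨n, hn⟩ := mem_iUnion.1 hyT
      exact mem_iUnion.2 ⟨n + 1, hsub n a ⟨y, hy, hn⟩ ha⟩
    · refine isOpen_iff_mem_nhds.2 fun x hx => ?_
      obtain ⟨a, ha⟩ := hmem x
      obtain ⟨n, hn⟩ := mem_iUnion.1 hx
      exact mem_of_superset ((hv a).mem_nhds ha)
        ((hsub n a ⟨x, ha, hn⟩).trans (subset_iUnion T (n + 1)))
  exact ⟨⟨T, hTc, hclopen.eq_univ ⟨x₀, mem_iUnion.2 ⟨0, rfl⟩⟩⟩⟩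

/-! ### From compact pieces to closed sets. -/

section Smoothing

variable {V : Type*} [NormedAddCommGroup V] [NormedSpace ℝ V] [FiniteDimensional ℝ V] {H : Type*}
  [TopologicalSpace H] (I : ModelWithCorners ℝ V H) {P : Type*} [TopologicalSpace P]
  [ChartedSpace H P] [IsManifold I ∞ P] [T2Space P] [SigmaCompactSpace P]
  {ι : Type*} {E : ι → Type*} [∀ i, AddCommGroup (E i)] [∀ i, Module ℝ (E i)]
  [∀ i, TopologicalSpace (E i)] [∀ i, IsTopologicalAddGroup (E i)] [∀ i, ContinuousSMul ℝ (E i)]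
  [∀ i, LocallyConvexSpace ℝ (E i)] [∀ i, T2Space (E i)] {N : Type*} [TopologicalSpace N]
  (𝒜 : LCAtlas E N)

/-- A countable family of local smoothings, supported in a locally finite family of compact sets,
can be carried out successively. -/
theorem exists_smoothing_of_locallyFinite (F : C(P, N)) {α : Type*} [Countable α]
    {K L : α → Set P} (hK : ∀ a, IsCompact (K a)) (hL : ∀ a, IsClosed (L a))
    (hLK : ∀ a, L a ⊆ interior (K a)) (hfin : LocallyFinite K) (i : α → ι)
    (hi : ∀ a, ∀ x ∈ K a, F x ∈ (𝒜.chart (i a)).source) :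
    ∃ G : C(P, N), (∀ x, (∀ a, x ∉ K a) → G x = F x) ∧ (∀ a, L a ⊆ smoothLocus I 𝒜 G) ∧
      smoothLocus I 𝒜 F ⊆ smoothLocus I 𝒜 G := by
  classical
  have := Encodable.ofCountable α
  -- `Ω` records that each `K a` is mapped into its assigned chart. Keeping every graph in `Ω`
  -- preserves this for later corrections; local finiteness makes `Ω` open.
  let Ω : Set (P × N) := (⋃ a, K a ×ˢ ((𝒜.chart (i a)).source)ᶜ)ᶜ
  have hΩ : IsOpen Ω := by
    refine (LocallyFinite.isClosed_iUnion ?_ fun a => ?_).isOpen_compl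
    · exact (hfin.preimage_continuous continuous_fst).subset fun a q hq => hq.1
    · exact (hK a).isClosed.prod (𝒜.chart (i a)).open_source.isClosed_compl
  have hΩ' : ∀ q : P × N, q ∈ Ω ↔ ∀ a, q.1 ∈ K a → q.2 ∈ (𝒜.chart (i a)).source := by
    intro q
    simp [Ω]
  let T := {G : C(P, N) // ∀ x, (x, G x) ∈ Ω}
  have step : ∀ (n : ℕ) (G : T), ∃ G' : T,
      (∀ x, G'.1 x ≠ G.1 x → ∃ a, Encodable.encode a = n ∧ x ∈ K a) ∧
      (∀ a, Encodable.encode a = n → L a ⊆ smoothLocus I 𝒜 G'.1) ∧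
      smoothLocus I 𝒜 G.1 ⊆ smoothLocus I 𝒜 G'.1 := by
    rintro n ⟨G, hG⟩
    by_cases h : ∃ a : α, Encodable.encode a = n
    · obtain ⟨a, rfl⟩ := h
      obtain ⟨G', h1, h2, h3, h4⟩ := exists_smoothing_of_isCompact (I := I) (𝒜 := 𝒜) G hΩ hG (hK a)
        (hL a) (hLK a) (i a) fun x hx => (hΩ' _).1 (hG x) a hx
      refine ⟨⟨G', h1⟩, fun x hx => ⟨a, rfl, by_contra fun hxK => hx (h2 x hxK)⟩,
        fun b hb => ?_, h4⟩
      rw [Encodable.encode_injective hb]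
      exact h3
    · exact ⟨⟨G, hG⟩, fun x hx => absurd rfl hx, fun a ha => absurd ⟨a, ha⟩ h, Subset.rfl⟩
  choose next hnext1 hnext2 hnext3 using step
  let f : ℕ → T := fun n => Nat.rec ⟨F, fun x => (hΩ' _).2 fun a => hi a x⟩ next n
  have hf : ∀ n, f (n + 1) = next n (f n) := fun _ => rfl
  have hlf : LocallyFinite fun n => {x | (f (n + 1)).1 x ≠ (f n).1 x} := by
    intro x
    obtain ⟨t, ht, hfin⟩ := hfin x
    refine ⟨t, ht, (hfin.image Encodable.encode).subset ?_⟩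
    rintro n ⟨y, hy, hyt⟩
    obtain ⟨a, han, hya⟩ := hnext1 n (f n) y hy
    exact ⟨a, ⟨y, hya, hyt⟩, han⟩
  obtain ⟨g, hg⟩ := LocallyFinite.exists_forall_eventually_atTop_eventuallyEq
    (f := fun n x => (f n).1 x) hlf
  have hgc : Continuous g := continuous_iff_continuousAt.2 fun x => by
    obtain ⟨n, hn⟩ := (hg x).exists
    exact ((f n).1.continuous.continuousAt).congr hn
  have hmono : Monotone fun n => smoothLocus I 𝒜 (f n).1 :=
    monotone_nat_of_le_succ fun n => hnext3 n (f n)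
  have hlim : ∀ n, smoothLocus I 𝒜 (f n).1 ⊆ smoothLocus I 𝒜 g := fun n x hx => by
    obtain ⟨m, hm, hnm⟩ := ((hg x).and (eventually_ge_atTop n)).exists
    exact smoothLocus_of_eventuallyEq (hmono hnm hx) hm
  refine ⟨⟨g, hgc⟩, fun x hx => ?_, fun a => ?_, hlim 0⟩
  · have hn : ∀ n, (f n).1 x = F x := by
      intro n
      induction n with
      | zero => rfl
      | succ n ih =>
        rw [← ih]
        by_contra hne
        obtain ⟨a, -, ha⟩ := hnext1 n (f n) x hne
        exact hx a ha
    obtain ⟨n, hn'⟩ := (hg x).exists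
    exact hn'.eq_of_nhds.symm.trans (hn n)
  · exact (hnext2 _ (f _) a rfl).trans (hlim (Encodable.encode a + 1))

/-- Relative smoothing: a continuous map can be made smooth near a closed set `A` without changing
it on a closed set `Z` disjoint from `A` and without destroying smoothness. -/
theorem exists_smoothing (F : C(P, N)) {Z A : Set P} (hZ : IsClosed Z) (hA : IsClosed A)
    (hZA : Disjoint Z A) :
    ∃ G : C(P, N), EqOn G F Z ∧ A ⊆ smoothLocus I 𝒜 G ∧
      smoothLocus I 𝒜 F ⊆ smoothLocus I 𝒜 G := by
  have : LocallyCompactSpace P := Manifold.locallyCompact_of_finiteDimensional I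
  choose i hi using fun x => 𝒜.cover (F x)
  let O : P → Set P := fun x => F ⁻¹' (𝒜.chart (i x)).source ∩ Zᶜ
  have hO : ∀ x, IsOpen (O x) := fun x =>
    ((𝒜.chart (i x)).open_source.preimage F.continuous).inter hZ.isOpen_compl
  have hbasis : ∀ x ∈ A, (𝓝 x).HasBasis
      (fun s : Set P => IsOpen s ∧ x ∈ s ∧ closure s ⊆ O x ∧ IsCompact (closure s)) id := by
    refine fun x hx => ⟨fun t => ⟨fun ht => ?_, ?_⟩⟩
    · obtain ⟨W, hW, hxW, hWO, hWc⟩ := exists_open_between_and_isCompact_closure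
        (isCompact_singleton (x := x)) ((hO x).inter isOpen_interior)
        (singleton_subset_iff.2 ⟨⟨hi x, fun h => disjoint_left.1 hZA h hx⟩,
          mem_interior_iff_mem_nhds.2 ht⟩)
      exact ⟨W, ⟨hW, hxW rfl, fun y hy => (hWO hy).1, hWc⟩,
        fun y hy => interior_subset (hWO (subset_closure hy)).2⟩
    · rintro ⟨s, ⟨hs, hxs, -⟩, hst⟩
      exact mem_of_superset (hs.mem_nhds hxs) hst
  obtain ⟨α, c, r, hr, hcov, hfin⟩ := refinement_of_locallyCompact_sigmaCompact_of_nhds_basis_set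
    hA hbasis
  have hcount : Countable α := countable_univ_iff.1
    (hfin.countable_univ fun a => ⟨c a, (hr a).2.2.1⟩)
  -- Shrinking the cover leaves room for the cutoffs: each closed piece `closure (v a)` sits in the
  -- open `r a`, and the pieces still cover `A`.
  obtain ⟨v, hAv, -, hv⟩ := exists_subset_iUnion_closure_subset hA (fun a => (hr a).2.1)
    (fun x _ => hfin.point_finite x) hcov
  obtain ⟨G, h1, h2, h3⟩ := exists_smoothing_of_locallyFinite I 𝒜 F
    (K := fun a => closure (r a)) (L := fun a => closure (v a)) (fun a => (hr a).2.2.2.2)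
    (fun a => isClosed_closure)
    (fun a => (hv a).trans (interior_maximal subset_closure (hr a).2.1)) hfin.closure
    (fun a => i (c a)) fun a x hx => ((hr a).2.2.2.1 hx).1
  refine ⟨G, fun x hx => h1 x fun a ha => ((hr a).2.2.2.1 ha).2 hx, fun x hx => ?_, h3⟩
  obtain ⟨a, ha⟩ := mem_iUnion.1 (hAv hx)
  exact h2 a (subset_closure ha)

end Smoothing

/-! ### Charts and smoothness on products. -/

section Product

variable {V₀ : Type*} [NormedAddCommGroup V₀] [NormedSpace ℝ V₀] {H₀ : Type*}
  [TopologicalSpace H₀] {I₀ : ModelWithCorners ℝ V₀ H₀} {P₀ : Type*} [TopologicalSpace P₀]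
  {V : Type*} [NormedAddCommGroup V] [NormedSpace ℝ V] {H : Type*}
  [TopologicalSpace H] {I : ModelWithCorners ℝ V H} {P : Type*} [TopologicalSpace P]
  {ι : Type*} {E : ι → Type*} [∀ i, AddCommGroup (E i)] [∀ i, Module ℝ (E i)]
  [∀ i, TopologicalSpace (E i)] {N : Type*} [TopologicalSpace N]
  {𝒜 : LCAtlas E N}

theorem mem_chartDomain_prod {e₀ : OpenPartialHomeomorph P₀ H₀} {e : OpenPartialHomeomorph P H}
    {W : Set (P₀ × P)} {y₀ : V₀} {y : V} :
    (y₀, y) ∈ chartDomain (I₀.prod I) (e₀.prod e) W ↔ y₀ ∈ (e₀.extend I₀).target ∧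
      y ∈ (e.extend I).target ∧ ((e₀.extend I₀).symm y₀, (e.extend I).symm y) ∈ W := by
  simp only [chartDomain, mem_inter_iff, mem_preimage]
  rw [← and_assoc]
  refine and_congr ?_ Iff.rfl
  simp only [OpenPartialHomeomorph.extend_target', ModelWithCorners.prod]
  constructor
  · rintro ⟨⟨a, b⟩, ⟨ha, hb⟩, h⟩
    obtain ⟨rfl, rfl⟩ := Prod.mk.inj h
    exact ⟨⟨a, ha, rfl⟩, ⟨b, hb, rfl⟩⟩
  · rintro ⟨⟨a, ha, rfl⟩, ⟨b, hb, rfl⟩⟩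
    exact ⟨(a, b), ⟨ha, hb⟩, rfl⟩

theorem interior_range_modelWithCorners_prod :
    interior (range (I₀.prod I)) = interior (range I₀) ×ˢ interior (range I) := by
  rw [← interior_prod_eq, ← range_prodMap]
  rfl

variable [ChartedSpace H₀ P₀] [ChartedSpace H P]

theorem IsSmoothMapOn.comp_snd {f : P → N} (hf : Continuous f) (h : IsSmoothMapOn I 𝒜 f univ) :
    IsSmoothMapOn (I₀.prod I) 𝒜 (fun p : P₀ × P => f p.2) univ := by
  rintro _ ⟨e₀, he₀, e, he, rfl⟩ i n
  have ho : IsOpen (univ ∩ f ⁻¹' (𝒜.chart i).source) :=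
    isOpen_univ.inter ((𝒜.chart i).open_source.preimage hf)
  have ho' : IsOpen (univ ∩ (fun p : P₀ × P => f p.2) ⁻¹' (𝒜.chart i).source) :=
    isOpen_univ.inter ((𝒜.chart i).open_source.preimage (by fun_prop))
  have hmaps : MapsTo (ContinuousLinearMap.snd ℝ V₀ V)
      (chartDomain (I₀.prod I) (e₀.prod e)
        (univ ∩ (fun p : P₀ × P => f p.2) ⁻¹' (𝒜.chart i).source))
      (chartDomain I e (univ ∩ f ⁻¹' (𝒜.chart i).source)) := by
    rintro ⟨y₀, y⟩ hy
    rw [mem_chartDomain_prod] at hy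
    exact ⟨hy.2.1, trivial, hy.2.2.2⟩
  refine (h e he i n).comp_clm (ContinuousLinearMap.snd ℝ V₀ V) hmaps ?_
  rw [interior_chartDomain _ _ ho, interior_chartDomain _ _ ho',
    interior_range_modelWithCorners_prod]
  exact fun y hy => ⟨hmaps hy.1, hy.2.2⟩

/-- The restriction of a smooth map on a product to a slice through an interior point. -/
theorem IsSmoothMapOn.slice [∀ i, IsTopologicalAddGroup (E i)]
    [∀ i, ContinuousSMul ℝ (E i)] [∀ i, LocallyConvexSpace ℝ (E i)]
    {F : P₀ × P → N} (hF : Continuous F) {W : Set (P₀ × P)}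
    (hW : IsOpen W) (h : IsSmoothMapOn (I₀.prod I) 𝒜 F W) {e₀ : OpenPartialHomeomorph P₀ H₀}
    (he₀ : e₀ ∈ atlas H₀ P₀) {t : P₀} (ht : t ∈ e₀.source)
    (hti : e₀.extend I₀ t ∈ interior (range I₀)) {W' : Set P} (hW' : IsOpen W')
    (hWW' : ∀ x ∈ W', (t, x) ∈ W) : IsSmoothMapOn I 𝒜 (fun x => F (t, x)) W' := by
  intro e he i n
  have ho : IsOpen (W ∩ F ⁻¹' (𝒜.chart i).source) :=
    hW.inter ((𝒜.chart i).open_source.preimage hF)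
  have ho' : IsOpen (W' ∩ (fun x => F (t, x)) ⁻¹' (𝒜.chart i).source) :=
    hW'.inter ((𝒜.chart i).open_source.preimage (by fun_prop))
  have hleft : (e₀.extend I₀).symm (e₀.extend I₀ t) = t := e₀.extend_left_inv ht
  have hmaps : MapsTo (fun y : V => (e₀.extend I₀ t, y))
      (chartDomain I e (W' ∩ (fun x => F (t, x)) ⁻¹' (𝒜.chart i).source))
      (chartDomain (I₀.prod I) (e₀.prod e) (W ∩ F ⁻¹' (𝒜.chart i).source)) := by
    rintro y ⟨hy, hyW, hyi⟩
    rw [mem_chartDomain_prod, hleft]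
    exact ⟨(e₀.extend I₀).map_source (by rwa [e₀.extend_source]), hy, hWW' _ hyW, hyi⟩
  refine ((h (e₀.prod e) (mem_image2_of_mem he₀ he) i n).comp
    ((BastianiOn.const n (e₀.extend I₀ t) _).pair (BastianiOn.clm n (.id ℝ V) _)) hmaps ?_).congr ?_
  -- That `t` is an interior point is used here: a slice through a boundary point would not send
  -- interior points to interior points.
  · intro y hy
    rw [interior_chartDomain I e ho'] at hy
    rw [interior_chartDomain _ _ ho, interior_range_modelWithCorners_prod]
    exact ⟨hmaps hy.1, hti, hy.2⟩
  · intro y hy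
    exact congrArg (fun s => 𝒜.chart i (F (s, (e.extend I).symm y))) hleft

end Product

/-! ### The two homotopy statements. -/

section Homotopy

variable {V : Type*} [NormedAddCommGroup V] [NormedSpace ℝ V] [FiniteDimensional ℝ V] {H : Type*}
  [TopologicalSpace H] {I : ModelWithCorners ℝ V H} {M : Type*} [TopologicalSpace M]
  [ChartedSpace H M] [IsManifold I ∞ M] [T2Space M] [SigmaCompactSpace M]
  {ι : Type*} {E : ι → Type*} [∀ i, AddCommGroup (E i)] [∀ i, Module ℝ (E i)]
  [∀ i, TopologicalSpace (E i)] [∀ i, IsTopologicalAddGroup (E i)] [∀ i, ContinuousSMul ℝ (E i)]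
  [∀ i, LocallyConvexSpace ℝ (E i)] [∀ i, T2Space (E i)] {N : Type*} [TopologicalSpace N]
  {𝒜 : LCAtlas E N}

variable (I 𝒜) in
/-- Every continuous map is homotopic to a smooth map. -/
theorem exists_isSmoothMap_homotopic (f : C(M, N)) :
    ∃ g : C(M, N), IsSmoothMap I 𝒜 g ∧ f.Homotopic g := by
  let F : C(unitInterval × M, N) := f.comp ContinuousMap.snd
  have hfst : Continuous fun p : unitInterval × M => (p.1 : ℝ) := by fun_prop
  obtain ⟨G, hG0, hG1, -⟩ := exists_smoothing ((𝓡∂ 1).prod I) 𝒜 F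
    (Z := {p | (p.1 : ℝ) ≤ 0}) (A := {p | (1 / 2 : ℝ) ≤ p.1})
    (isClosed_le hfst continuous_const) (isClosed_le continuous_const hfst)
    (disjoint_left.2 fun p (h0 : (p.1 : ℝ) ≤ 0) (h1 : (1 / 2 : ℝ) ≤ p.1) => by linarith)
  -- Any time strictly between `1/2` and `1` would do: it lies in the smoothed region and is an
  -- interior point of the left chart.
  let t : unitInterval := ⟨3 / 4, by norm_num, by norm_num⟩
  have hW : IsOpen {p : unitInterval × M | (1 / 2 : ℝ) < p.1} := isOpen_lt continuous_const hfst
  have hsm := IsSmoothMapOn.of_subset_smoothLocus G.continuous hW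
    (fun p hp => hG1 (show (1 / 2 : ℝ) ≤ p.1 from le_of_lt hp))
  have hslice : IsSmoothMapOn I 𝒜 (fun x => G (t, x)) univ := by
    refine hsm.slice G.continuous hW (e₀ := IccLeftChart 0 1) (t := t) (Or.inl rfl) ?_ ?_
      isOpen_univ fun x _ => ?_
    · change (3 / 4 : ℝ) < 1
      norm_num
    · rw [interior_range_modelWithCornersEuclideanHalfSpace]
      exact IccLeftChart_extend_interior_pos ⟨by norm_num [t], by norm_num [t]⟩
    · change (1 / 2 : ℝ) < 3 / 4
      norm_num
  have hgc : Continuous fun x => G (t, x) := by fun_prop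
  -- The homotopy runs through `G` at time `s * t`, from the unchanged slice at `0` to the smooth
  -- slice at `t`.
  refine ⟨⟨fun x => G (t, x), hgc⟩, isSmoothMap_iff.2 ⟨hgc, ?_⟩, ⟨⟨⟨fun p => G (p.1 * t, p.2),
    by fun_prop⟩, fun x => ?_, fun x => ?_⟩⟩⟩
  · exact eq_univ_of_forall fun x => ⟨univ, isOpen_univ, trivial, hslice⟩
  · change G (0 * t, x) = f x
    rw [zero_mul]
    exact hG0 (le_refl (0 : ℝ))
  · change G (1 * t, x) = G (t, x)
    rw [one_mul]

/-- Homotopic smooth maps are smoothly homotopic. -/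
theorem exists_isSmoothMap_homotopy {f g : C(M, N)} (hf : IsSmoothMap I 𝒜 f)
    (hg : IsSmoothMap I 𝒜 g) (h : f.Homotopic g) :
    ∃ F : unitInterval × M → N, IsSmoothMap ((𝓡∂ 1).prod I) 𝒜 F ∧
      (∀ x, F (0, x) = f x) ∧ (∀ x, F (1, x) = g x) := by
  obtain ⟨Φ⟩ := h
  -- Clamping makes `σ` equal to `0` up to time `1/4` and to `1` from time `3/4`, so the
  -- reparametrized homotopy is already smooth near both ends.
  let σ : unitInterval → unitInterval := fun t => projIcc 0 1 zero_le_one (2 * (t : ℝ) - 1 / 2)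
  have hσ : Continuous σ := by
    refine continuous_projIcc.comp ?_
    fun_prop
  let F : C(unitInterval × M, N) := ⟨fun p => Φ (σ p.1, p.2), by fun_prop⟩
  have hF0 : ∀ p : unitInterval × M, (p.1 : ℝ) ≤ 1 / 4 → F p = f p.2 := fun p hp => by
    have : σ p.1 = 0 := projIcc_of_le_left _ (by linarith)
    change Φ (σ p.1, p.2) = _
    rw [this, Φ.apply_zero]
  have hF1 : ∀ p : unitInterval × M, 3 / 4 ≤ (p.1 : ℝ) → F p = g p.2 := fun p hp => by
    have : σ p.1 = 1 := projIcc_of_right_le _ (by linarith)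
    change Φ (σ p.1, p.2) = _
    rw [this, Φ.apply_one]
  have hfst : Continuous fun p : unitInterval × M => (p.1 : ℝ) := by fun_prop
  -- The interval `[1/5, 4/5]` contains `[1/4, 3/4]`, outside which `F` is already smooth, and it
  -- avoids the end times, where `F` must be kept.
  obtain ⟨G, hGF, hG1, hG2⟩ := exists_smoothing ((𝓡∂ 1).prod I) 𝒜 F
    (Z := {p | (p.1 : ℝ) ≤ 0} ∪ {p | 1 ≤ (p.1 : ℝ)})
    (A := {p | (1 / 5 : ℝ) ≤ p.1} ∩ {p | (p.1 : ℝ) ≤ 4 / 5})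
    ((isClosed_le hfst continuous_const).union (isClosed_le continuous_const hfst))
    ((isClosed_le continuous_const hfst).inter (isClosed_le hfst continuous_const))
    (disjoint_left.2 (by
      rintro p (h0 : (p.1 : ℝ) ≤ 0 ∨ 1 ≤ (p.1 : ℝ)) ⟨h1 : (1 / 5 : ℝ) ≤ p.1, h2 : (p.1 : ℝ) ≤ 4 / 5⟩
      rcases h0 with h0 | h0 <;> linarith))
  have hsnd : ∀ k : C(M, N), IsSmoothMap I 𝒜 k →
      IsSmoothMapOn ((𝓡∂ 1).prod I) 𝒜 (fun p : unitInterval × M => k p.2) univ := fun k hk =>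
    IsSmoothMapOn.comp_snd k.continuous (IsSmoothMapOn.of_subset_smoothLocus k.continuous
      isOpen_univ (isSmoothMap_iff.1 hk).2.ge)
  refine ⟨G, isSmoothMap_iff.2 ⟨G.continuous, eq_univ_of_forall fun p => ?_⟩, fun x => ?_,
    fun x => ?_⟩
  · rcases lt_or_ge (p.1 : ℝ) (1 / 4) with h1 | h1
    · exact hG2 ⟨{p | (p.1 : ℝ) < 1 / 4}, isOpen_lt hfst continuous_const, h1,
        ((hsnd f hf).mono (subset_univ _)).congr fun q hq => (hF0 q (le_of_lt hq)).symm⟩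
    rcases lt_or_ge (3 / 4) (p.1 : ℝ) with h2 | h2
    · exact hG2 ⟨{p | 3 / 4 < (p.1 : ℝ)}, isOpen_lt continuous_const hfst, h2,
        ((hsnd g hg).mono (subset_univ _)).congr fun q hq => (hF1 q (le_of_lt hq)).symm⟩
    · exact hG1 ⟨show (1 / 5 : ℝ) ≤ p.1 by linarith, show (p.1 : ℝ) ≤ 4 / 5 by linarith⟩
  · exact (hGF (Or.inl (le_refl (0 : ℝ)))).trans (hF0 (0, x) (by norm_num))
  · exact (hGF (Or.inr (le_refl (1 : ℝ)))).trans (hF1 (1, x) (by norm_num))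

end Homotopy

theorem mainTheorem4 {d : ℕ}
    {M : Type*} [TopologicalSpace M] [T2Space M] [ParacompactSpace M] [ConnectedSpace M]
    [ChartedSpace (EuclideanQuadrant d) M]
    [IsManifold (modelWithCornersEuclideanQuadrant d) ∞ M]
    {ι : Type*} {E : ι → Type*} [∀ i, AddCommGroup (E i)] [∀ i, Module ℝ (E i)]
    [∀ i, TopologicalSpace (E i)] [∀ i, IsTopologicalAddGroup (E i)]
    [∀ i, ContinuousSMul ℝ (E i)] [∀ i, LocallyConvexSpace ℝ (E i)] [∀ i, T2Space (E i)]
    {N : Type*} [TopologicalSpace N] [T2Space N] (𝒜 : LCAtlas E N) :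
    (∀ f : C(M, N), ∃ g : C(M, N),
      IsSmoothMap (modelWithCornersEuclideanQuadrant d) 𝒜 g ∧ f.Homotopic g) ∧
    (∀ f g : C(M, N),
      IsSmoothMap (modelWithCornersEuclideanQuadrant d) 𝒜 f →
      IsSmoothMap (modelWithCornersEuclideanQuadrant d) 𝒜 g →
      (f.Homotopic g ↔
        ∃ F : unitInterval × M → N,
          IsSmoothMap ((𝓡∂ 1).prod (modelWithCornersEuclideanQuadrant d)) 𝒜 F ∧
          (∀ x, F (0, x) = f x) ∧ (∀ x, F (1, x) = g x))) := by
  have : LocallyCompactSpace M :=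
    Manifold.locallyCompact_of_finiteDimensional (modelWithCornersEuclideanQuadrant d)
  have : SigmaCompactSpace M := .of_connected_paracompact M
  refine ⟨exists_isSmoothMap_homotopic _ 𝒜, fun f g hf hg =>
    ⟨exists_isSmoothMap_homotopy hf hg, fun ⟨F, hF, h0, h1⟩ => ?_⟩⟩
  exact ⟨⟨⟨F, hF.1⟩, h0, h1⟩⟩
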